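/- Let $k\ge 2$ and let $V$ be the vertex set of the infinite rooted $k$-ary tree, in which every vertex $x$ has a set $\mathcal K_x$ of $k$ children. For $p\in[0,1]$ let $\mu=\mu_p$ be the product measure on $\Omega=\{0,1\}^V$ whose marginals are Bernoulli with $\mu_x(1)=p$, $\mu_x(0)=1-p$. The OFA-kf process at density $p$ is the Markov process on $\Omega$, reversible with respect to $\mu$, whose generator $\mathcal L=\mathcal L_p$ acts on functions $f$ of finitely many coordinates by $$\mathcal L f(\omega)=\sum_{x\in V}c_x(\omega)\,[\mu_x(f)(\omega)-f(\omega)],$$ where $c_x(\omega)=1$ if $\omega_y=0$ for all $y\in\mathcal K_x$ and $c_x(\omega)=0$ otherwise, and $\mu_x(f)$ is the average of $f$ over the variable at $x$ with all the other variables fixed; $\mathcal L$ also denotes the closure of this operator in $L^2(\mu)$. Let $$p_c=p_c(k)=\sup\{p\in[0,1):\ 0 \text{ is a simple eigenvalue of } \mathcal L_p\},$$ $$\operatorname{gap}(\mathcal L)=\inf\Bigl\{\frac{\mu(f\cdot(-\mathcal L f))}{\operatorname{Var}_\mu(f)}:\ f\in\operatorname{Dom}(\mathcal L),\ f \text{ not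 } \mu\text{-a.e. constant}\Bigr\},$$ and let $T_{\rm rel}=T_{\rm rel}(k,p)=\operatorname{gap}(\mathcal L)^{-1}\in[0,\infty]$ be the relaxation time. Theorem. There is a constant $\alpha\ge 0$ such that for every $k\ge 2$ there is a constant $a=a(k)>0$ such that, for all $p$ with $0<p<p_c$, $$a^{-1}(p_c-p)^{-2}\ \le\ T_{\rm rel}\ \le\ a\,(p_c-p)^{-(2+\alpha)} .$$ -/

import Mathlib

open MeasureTheory ProbabilityTheory
open scoped ENNReal unitInterval

namespace OFA

/-- Vertices of the infinite rooted `k`-ary tree, coded as words over `Fin k`: the root is `[]`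
and the children of `x` are the `k` words `i :: x`. -/
abbrev Vertex (k : ℕ) : Type := List (Fin k)

/-- Configurations `{0,1}^V`; `true` stands for `1` (occupied), `false` for `0` (empty). -/
abbrev Config (k : ℕ) : Type := Vertex k → Bool

/-- The Bernoulli measure on `{0,1}` giving mass `p` to `1` and `1 - p` to `0`. -/
noncomputable abbrev siteMeasure (p : I) : Measure Bool := bernoulliMeasure true false p

/-- The product Bernoulli(`p`) measure `μ` on configurations. -/
noncomputable abbrev μ (k : ℕ) (p : I) : Measure (Config k) :=
  Measure.infinitePi fun _ : Vertex k => siteMeasure p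

/-- Local functions: functions of finitely many coordinates. -/
def IsLocal {k : ℕ} (f : Config k → ℝ) : Prop :=
  ∃ S : Finset (Vertex k), DependsOn f (S : Set (Vertex k))

open Classical in
/-- The constraint at `x`: it is `1` if all children of `x` are empty and `0` otherwise. -/
noncomputable def constraint {k : ℕ} (x : Vertex k) (ω : Config k) : ℝ :=
  if ∀ i : Fin k, ω (i :: x) = false then 1 else 0

/-- `μ_x(f)(ω)`: the average of `f` over the variable at `x`, the others being frozen in `ω`. -/
noncomputable def siteMean {k : ℕ} (p : I) (x : Vertex k) (f : Config k → ℝ) (ω : Config k) : ℝ :=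
  ∫ s, f (Function.update ω x s) ∂(siteMeasure p)

/-- The OFA-kf generator on local functions,
`(𝓛 f)(ω) = ∑_x c_x(ω) [μ_x(f)(ω) - f(ω)]`; for local `f` only finitely many terms are nonzero. -/
noncomputable def localGenerator {k : ℕ} (p : I) (f : Config k → ℝ) (ω : Config k) : ℝ :=
  ∑ᶠ x : Vertex k, constraint x ω * (siteMean p x f ω - f ω)

theorem siteMean_add {k : ℕ} (p : I) (x : Vertex k) (f g : Config k → ℝ) (ω : Config k) :
    siteMean p x (f + g) ω = siteMean p x f ω + siteMean p x g ω := by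
  simp only [siteMean, Pi.add_apply]
  exact integral_add Integrable.of_finite Integrable.of_finite

theorem siteMean_smul {k : ℕ} (p : I) (x : Vertex k) (a : ℝ) (f : Config k → ℝ) (ω : Config k) :
    siteMean p x (a • f) ω = a * siteMean p x f ω := by
  simp only [siteMean, Pi.smul_apply, smul_eq_mul]
  exact integral_const_mul a _

theorem IsLocal.add {k : ℕ} {f g : Config k → ℝ} (hf : IsLocal f) (hg : IsLocal g) :
    IsLocal (f + g) := by
  obtain ⟨S, hS⟩ := hf
  obtain ⟨T, hT⟩ := hg
  refine ⟨S ∪ T, fun ω η h => ?_⟩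
  have h1 := hS fun i hi => h i (by simp only [Finset.coe_union]; exact Or.inl hi)
  have h2 := hT fun i hi => h i (by simp only [Finset.coe_union]; exact Or.inr hi)
  simp only [Pi.add_apply, h1, h2]

theorem IsLocal.smul {k : ℕ} {f : Config k → ℝ} (a : ℝ) (hf : IsLocal f) : IsLocal (a • f) := by
  obtain ⟨S, hS⟩ := hf
  exact ⟨S, fun ω η h => by simp only [Pi.smul_apply, hS h]⟩

/-- The sum that defines `𝓛 f` is finite when `f` is local. -/
theorem IsLocal.finite_support {k : ℕ} {f : Config k → ℝ} (hf : IsLocal f) (p : I)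
    (ω : Config k) :
    (Function.support fun x : Vertex k => constraint x ω * (siteMean p x f ω - f ω)).Finite := by
  obtain ⟨S, hS⟩ := hf
  refine S.finite_toSet.subset fun x hx => ?_
  by_contra hxS
  refine hx ?_
  have h : ∀ s, f (Function.update ω x s) = f ω := fun s => hS fun i hi => by
    have hne : i ≠ x := fun h => hxS (h ▸ hi)
    simp [Function.update_of_ne hne]
  simp [siteMean, h]

theorem localGenerator_add {k : ℕ} (p : I) {f g : Config k → ℝ} (hf : IsLocal f)
    (hg : IsLocal g) :
    localGenerator p (f + g) = localGenerator p f + localGenerator p g := by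
  ext ω
  simp only [localGenerator, Pi.add_apply]
  rw [← finsum_add_distrib (hf.finite_support p ω) (hg.finite_support p ω)]
  refine finsum_congr fun x => ?_
  rw [siteMean_add]
  ring

theorem localGenerator_smul {k : ℕ} (p : I) (a : ℝ) (f : Config k → ℝ) :
    localGenerator p (a • f) = a • localGenerator p f := by
  ext ω
  simp only [localGenerator, Pi.smul_apply, smul_eq_mul]
  refine (finsum_congr fun x => ?_).trans (smul_finsum a _).symm
  rw [siteMean_smul, smul_eq_mul]
  ring

/-- The real Hilbert space `L²(μ)`. -/
abbrev L2 (k : ℕ) (p : I) : Type := Lp ℝ 2 (μ k p)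

/-- The graph, in `L²(μ) × L²(μ)`, of `𝓛` restricted to local functions. -/
noncomputable def localGraph (k : ℕ) (p : I) : Submodule ℝ (L2 k p × L2 k p) where
  carrier := {u | ∃ f : Config k → ℝ, IsLocal f ∧
    u.1 =ᵐ[μ k p] f ∧ u.2 =ᵐ[μ k p] localGenerator p f}
  zero_mem' := by
    refine ⟨(0 : ℝ) • (0 : Config k → ℝ), ⟨∅, fun _ _ _ => rfl⟩, ?_, ?_⟩
    · rw [zero_smul]
      exact Lp.coeFn_zero _ _ _
    · rw [localGenerator_smul, zero_smul]
      exact Lp.coeFn_zero _ _ _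
  add_mem' := by
    rintro u v ⟨f, hf, hf1, hf2⟩ ⟨g, hg, hg1, hg2⟩
    refine ⟨f + g, hf.add hg, ?_, ?_⟩
    · exact (Lp.coeFn_add u.1 v.1).trans (hf1.add hg1)
    · rw [localGenerator_add p hf hg]
      exact (Lp.coeFn_add u.2 v.2).trans (hf2.add hg2)
  smul_mem' := by
    rintro a u ⟨f, hf, hf1, hf2⟩
    refine ⟨a • f, hf.smul a, ?_, ?_⟩
    · exact (Lp.coeFn_smul a u.1).trans (hf1.const_smul a)
    · rw [localGenerator_smul]
      exact (Lp.coeFn_smul a u.2).trans (hf2.const_smul a)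

/-- The generator `𝓛` on `L²(μ)`: the closure of its restriction to local functions (which is a
core). The operator is given through its graph, so `(f, g) ∈ generator k p` means that
`f ∈ Dom(𝓛)` and `𝓛 f = g`. -/
noncomputable def generator (k : ℕ) (p : I) : Submodule ℝ (L2 k p × L2 k p) :=
  (localGraph k p).topologicalClosure

/-- The kernel of `𝓛`, i.e. the eigenspace of the eigenvalue `0`. -/
noncomputable def generatorKer (k : ℕ) (p : I) : Submodule ℝ (L2 k p) :=
  (generator k p).comap (LinearMap.inl ℝ (L2 k p) (L2 k p))

/-- `0` is a simple eigenvalue of `𝓛`: its eigenspace has dimension one. -/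
def ZeroIsSimpleEigenvalue (k : ℕ) (p : I) : Prop :=
  Module.finrank ℝ (generatorKer k p) = 1

/-- The critical density: the supremum of the densities at which `0` is a simple eigenvalue of
`𝓛`. The value `p = 1` is left out, as `μ` is then a point mass and `L²(μ)` one-dimensional. -/
noncomputable def criticalDensity (k : ℕ) : ℝ :=
  sSup {r : ℝ | ∃ p : I, (p : ℝ) = r ∧ r < 1 ∧ ZeroIsSimpleEigenvalue k p}

/-- The spectral gap of `𝓛`: the infimum of `𝓓(f) / Var(f)`, with `𝓓(f) = μ(f, -𝓛 f)`, over all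
`f ∈ Dom(𝓛)` that are not almost everywhere constant; here `g = 𝓛 f`. -/
noncomputable def spectralGap (k : ℕ) (p : I) : ℝ≥0∞ :=
  ⨅ (f : L2 k p) (g : L2 k p) (_ : (f, g) ∈ generator k p)
    (_ : ¬ ∃ c : ℝ, f =ᵐ[μ k p] fun _ => c),
    ENNReal.ofReal (inner ℝ f (-g) / variance f (μ k p))

/-- The relaxation time `gap(𝓛)⁻¹`, which is `∞` when the gap is `0`. -/
noncomputable def relaxationTime (k : ℕ) (p : I) : ℝ≥0∞ := (spectralGap k p)⁻¹

end OFA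

namespace OFA

variable {k : ℕ} {p : I}

/-! ### Averages over finite sets of coordinates -/

/-! The critical density is `1 / k`, the point where the occupied cluster of a vertex becomes a
supercritical branching process. Put `ε = 1 - p * k`.

Upper bound. List the vertices level by level and split the variance of a local function into
martingale increments, one per vertex (`blockVar_eq_sum`). In the increment at `x`, insert the
indicator that no long occupied path starts from the children of `x`. The complementary event has
small probability, so its contribution can be absorbed into the total variance
(`blockVar_le_sum_constraint`). On the retained event, `x` lies in a region found by exploring from
below: the region is determined by the coordinates outside it, and its lower boundary is empty.
Given the region, the coordinates inside still have the product law, so a finite-volume Poincaré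
inequality with empty boundary applies there (`sum_blockVar_indicator_le`,
`RegionPoincare.explored`).

The finite-volume constant is polynomial in the number `n` of levels (`regionPoincare_pow`). For `p
* k ≤ 1`, an occupied path of length `d` exists with probability at most `4 / (d + 4)`, uniformly in
`k`. This makes a bisection work: at the price of a constant factor, `n` levels reduce to a fixed
fraction of `n`. Below criticality the path probability also decays like `(1 - ε) ^ l`, so regions
of depth `l` of order `ε⁻²` suffice. This gives a Poincaré constant of order `l ^ 81`, that is `ε ^
(-162)`. The inequality passes to the closed generator because it is a closed condition on its
graph.

Lower bound. The test function is a truncation of the size of the root cluster. The constraint at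
`x` kills the influence of `x` on all its descendants, so the Dirichlet form sees each vertex only
through its own increment, whereas in the variance each increment is multiplied by the mean size
`ε⁻¹` of the progeny (`cluster_eq_of_subcritical`). The ratio is of order `ε ^ 2`.

Critical density. Below `1 / k` the Poincaré inequality leaves only constants in the kernel. Above
`1 / k`, the branching martingale `Z_n / (p * k) ^ n` converges in `L²` to a nonconstant limit,
while its images under the generator tend to `0`; hence the kernel is larger
(`not_zeroIsSimpleEigenvalue`). -/

theorem siteMean_eq (p : I) (x : Vertex k) (f : Config k → ℝ) (ω : Config k) :
    siteMean p x f ω =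
      p * f (Function.update ω x true) + (1 - p) * f (Function.update ω x false) := by
  rw [siteMean, siteMeasure, integral_bernoulliMeasure, smul_eq_mul, smul_eq_mul]

/-- `siteMean` as a linear endomorphism. -/
noncomputable def siteMeanHom (p : I) (x : Vertex k) : Module.End ℝ (Config k → ℝ) where
  toFun := siteMean p x
  map_add' f g := funext fun ω => siteMean_add p x f g ω
  map_smul' a f := funext fun ω => siteMean_smul p x a f ω

theorem siteMeanHom_apply (x : Vertex k) (f : Config k → ℝ) :
    siteMeanHom p x f = siteMean p x f := rfl

theorem siteMeanHom_commute (p : I) (x y : Vertex k) :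
    Commute (siteMeanHom p x) (siteMeanHom p y) := by
  rcases eq_or_ne x y with rfl | h
  · exact Commute.refl _
  · refine LinearMap.ext fun f => funext fun ω => ?_
    simp only [Module.End.mul_apply, siteMeanHom_apply, siteMean_eq]
    simp only [Function.update_comm h]
    ring

theorem siteMeanHom_mul_self (p : I) (x : Vertex k) :
    siteMeanHom p x * siteMeanHom p x = siteMeanHom p x := by
  refine LinearMap.ext fun f => funext fun ω => ?_
  simp only [Module.End.mul_apply, siteMeanHom_apply, siteMean_eq, Function.update_idem]
  ring

theorem siteMeanHom_pairwise (p : I) (A : Finset (Vertex k)) :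
    (A : Set (Vertex k)).Pairwise (Function.onFun Commute (siteMeanHom p)) :=
  fun x _ y _ _ => siteMeanHom_commute p x y

/-- The average over the coordinates in the finite set `A`. -/
noncomputable def blockMean (p : I) (A : Finset (Vertex k)) : Module.End ℝ (Config k → ℝ) :=
  A.noncommProd (siteMeanHom p) (siteMeanHom_pairwise p A)

@[simp] theorem blockMean_empty (f : Config k → ℝ) : blockMean p ∅ f = f := by
  rw [blockMean, Finset.noncommProd_empty, Module.End.one_apply]

theorem blockMean_insert (x : Vertex k) (A : Finset (Vertex k)) (f : Config k → ℝ) :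
    blockMean p (insert x A) f = siteMean p x (blockMean p A f) := by
  have key : ∀ B : Finset (Vertex k), x ∉ B →
      blockMean p (insert x B) = siteMeanHom p x * blockMean p B := fun B hB =>
    Finset.noncommProd_insert_of_notMem B x _ _ hB
  by_cases h : x ∈ A
  · have h1 := key (A.erase x) (by simp)
    rw [Finset.insert_erase h] at h1
    rw [Finset.insert_eq_of_mem h, ← siteMeanHom_apply, h1, ← Module.End.mul_apply, ← mul_assoc,
      siteMeanHom_mul_self]
  · rw [key A h]; rfl

theorem blockMean_singleton (x : Vertex k) (f : Config k → ℝ) :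
    blockMean p {x} f = siteMean p x f := by
  rw [← insert_empty_eq, blockMean_insert, blockMean_empty]

theorem blockMean_blockMean (A B : Finset (Vertex k)) (f : Config k → ℝ) :
    blockMean p A (blockMean p B f) = blockMean p (A ∪ B) f := by
  induction A using Finset.induction_on with
  | empty => simp
  | insert x A _ ih => rw [Finset.insert_union, blockMean_insert, blockMean_insert, ih]

theorem blockMean_comm (A B : Finset (Vertex k)) (f : Config k → ℝ) :
    blockMean p A (blockMean p B f) = blockMean p B (blockMean p A f) := by
  rw [blockMean_blockMean, blockMean_blockMean, Finset.union_comm]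

theorem blockMean_of_subset {A B : Finset (Vertex k)} (h : B ⊆ A) (f : Config k → ℝ) :
    blockMean p A (blockMean p B f) = blockMean p A f := by
  rw [blockMean_blockMean, Finset.union_eq_left.2 h]

theorem siteMean_mono {x : Vertex k} {f g : Config k → ℝ} (h : ∀ ω, f ω ≤ g ω) (ω : Config k) :
    siteMean p x f ω ≤ siteMean p x g ω := by
  rw [siteMean_eq, siteMean_eq]
  have h0 := p.2.1
  have h1 : 0 ≤ 1 - (p : ℝ) := sub_nonneg.2 p.2.2
  have := h (Function.update ω x true)
  have := h (Function.update ω x false)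
  gcongr

theorem blockMean_mono {f g : Config k → ℝ} (h : ∀ ω, f ω ≤ g ω) (A : Finset (Vertex k))
    (ω : Config k) : blockMean p A f ω ≤ blockMean p A g ω := by
  induction A using Finset.induction_on generalizing ω with
  | empty => simpa using h ω
  | insert x A _ ih => rw [blockMean_insert, blockMean_insert]; exact siteMean_mono ih ω

/-- `AgreeOff A ω ω'`: the two configurations coincide outside of `A`. -/
def AgreeOff (A : Finset (Vertex k)) (ω ω' : Config k) : Prop := ∀ v, v ∉ A → ω' v = ω v

theorem AgreeOff.refl (A : Finset (Vertex k)) (ω : Config k) : AgreeOff A ω ω := fun _ _ => rfl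

theorem AgreeOff.mono {A B : Finset (Vertex k)} (h : A ⊆ B) {ω ω' : Config k}
    (hω : AgreeOff A ω ω') : AgreeOff B ω ω' := fun v hv => hω v fun hA => hv (h hA)

/-- `blockMean p A f ω` only involves the values of `f` at configurations that agree with `ω`
off `A`. -/
theorem blockMean_congr {A : Finset (Vertex k)} {f g : Config k → ℝ} {ω : Config k}
    (h : ∀ ω', AgreeOff A ω ω' → f ω' = g ω') : blockMean p A f ω = blockMean p A g ω := by
  induction A using Finset.induction_on generalizing ω with
  | empty => simpa using h ω (AgreeOff.refl _ _)
  | insert x A _ ih =>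
    have key : ∀ b, blockMean p A f (Function.update ω x b) =
        blockMean p A g (Function.update ω x b) := fun b => ih fun ω' hω' => h ω' fun v hv => by
      rw [Finset.mem_insert, not_or] at hv
      rw [hω' v hv.2, Function.update_of_ne hv.1]
    rw [blockMean_insert, blockMean_insert, siteMean_eq, siteMean_eq, key, key]

theorem blockMean_const (A : Finset (Vertex k)) (a : ℝ) (ω : Config k) :
    blockMean p A (fun _ => a) ω = a := by
  induction A using Finset.induction_on generalizing ω with
  | empty => simp
  | insert x A _ ih => rw [blockMean_insert, siteMean_eq, ih, ih]; ring

theorem blockMean_eq_self {A : Finset (Vertex k)} {f : Config k → ℝ} {ω : Config k}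
    (h : ∀ ω', AgreeOff A ω ω' → f ω' = f ω) : blockMean p A f ω = f ω :=
  (blockMean_congr h).trans (blockMean_const A _ ω)

theorem blockMean_const_mul (A : Finset (Vertex k)) (a : ℝ) (f : Config k → ℝ) (ω : Config k) :
    blockMean p A (fun η => a * f η) ω = a * blockMean p A f ω := by
  have : (fun η => a * f η) = a • f := rfl
  rw [this, map_smul]; rfl

theorem blockMean_add (A : Finset (Vertex k)) (f g : Config k → ℝ) (ω : Config k) :
    blockMean p A (fun η => f η + g η) ω = blockMean p A f ω + blockMean p A g ω := by
  have : (fun η => f η + g η) = f + g := rfl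
  rw [this, map_add]; rfl

theorem blockMean_sub (A : Finset (Vertex k)) (f g : Config k → ℝ) (ω : Config k) :
    blockMean p A (fun η => f η - g η) ω = blockMean p A f ω - blockMean p A g ω := by
  have : (fun η => f η - g η) = f - g := rfl
  rw [this, map_sub]; rfl

theorem blockMean_sum {ι : Type*} (A : Finset (Vertex k)) (s : Finset ι) (f : ι → Config k → ℝ)
    (ω : Config k) :
    blockMean p A (fun η => ∑ i ∈ s, f i η) ω = ∑ i ∈ s, blockMean p A (f i) ω := by
  have : (fun η => ∑ i ∈ s, f i η) = ∑ i ∈ s, f i := by ext; simp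
  rw [this, map_sum, Finset.sum_apply]

/-- A factor that is constant on the fibre of `ω` comes out of the average. -/
theorem blockMean_mul_left {A : Finset (Vertex k)} {g : Config k → ℝ} {ω : Config k}
    (h : ∀ ω', AgreeOff A ω ω' → g ω' = g ω) (f : Config k → ℝ) :
    blockMean p A (fun η => g η * f η) ω = g ω * blockMean p A f ω := by
  rw [← blockMean_const_mul]
  exact blockMean_congr fun ω' hω' => by simp [h ω' hω']

theorem blockMean_nonneg {A : Finset (Vertex k)} {f : Config k → ℝ} (h : ∀ ω, 0 ≤ f ω)
    (ω : Config k) : 0 ≤ blockMean p A f ω :=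
  (blockMean_const A 0 ω).symm.le.trans (blockMean_mono h A ω)

theorem blockMean_fibre (A : Finset (Vertex k)) (f : Config k → ℝ) {ω ω' : Config k}
    (h : AgreeOff A ω ω') : blockMean p A f ω' = blockMean p A f ω := by
  induction A using Finset.induction_on generalizing ω ω' with
  | empty =>
    have : ω' = ω := funext fun v => h v (by simp)
    rw [this]
  | insert x A _ ih =>
    have key : ∀ b, blockMean p A f (Function.update ω' x b) =
        blockMean p A f (Function.update ω x b) := fun b => ih fun v hv => by
      rcases eq_or_ne v x with rfl | hx
      · simp
      · rw [Function.update_of_ne hx, Function.update_of_ne hx, h v (by simp [hx, hv])]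
    rw [blockMean_insert, siteMean_eq, siteMean_eq, key, key]

/-- Cauchy–Schwarz, from the discriminant of the nonnegative quadratic `t ↦ blockMean p A ((t f + g)
^ 2)`. -/
theorem blockMean_mul_le (A : Finset (Vertex k)) (f g : Config k → ℝ) (ω : Config k) :
    (blockMean p A (fun η => f η * g η) ω) ^ 2 ≤
      blockMean p A (fun η => f η ^ 2) ω * blockMean p A (fun η => g η ^ 2) ω := by
  set a := blockMean p A (fun η => f η ^ 2) ω
  set b := blockMean p A (fun η => f η * g η) ω with hb
  set c := blockMean p A (fun η => g η ^ 2) ω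
  have key : ∀ t : ℝ, 0 ≤ a * (t * t) + (2 * b) * t + c := fun t => by
    have h : 0 ≤ blockMean p A (fun η => (t * f η + g η) ^ 2) ω :=
      blockMean_nonneg (fun η => sq_nonneg _) ω
    have e : (fun η => (t * f η + g η) ^ 2) =
        fun η => (t * t) * f η ^ 2 + ((2 * t) * (f η * g η) + g η ^ 2) := by ext; ring
    rw [e, blockMean_add, blockMean_add, blockMean_const_mul, blockMean_const_mul] at h
    linarith
  have := discrim_le_zero key
  rw [discrim] at this
  linarith

theorem blockMean_sq_le (A : Finset (Vertex k)) (f : Config k → ℝ) (ω : Config k) :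
    (blockMean p A f ω) ^ 2 ≤ blockMean p A (fun η => f η ^ 2) ω := by
  simpa [blockMean_const] using blockMean_mul_le (p := p) A (fun _ => 1) f ω

/-! ### Conditional variances -/

/-- The variance with respect to the coordinates in `A`, the others being frozen. -/
noncomputable def blockVar (p : I) (A : Finset (Vertex k)) (f : Config k → ℝ) (ω : Config k) : ℝ :=
  blockMean p A (fun η => f η ^ 2) ω - (blockMean p A f ω) ^ 2

theorem blockVar_nonneg (A : Finset (Vertex k)) (f : Config k → ℝ) (ω : Config k) :
    0 ≤ blockVar p A f ω := sub_nonneg.2 (blockMean_sq_le A f ω)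

theorem blockVar_congr {A : Finset (Vertex k)} {f g : Config k → ℝ} {ω : Config k}
    (h : ∀ ω', AgreeOff A ω ω' → f ω' = g ω') : blockVar p A f ω = blockVar p A g ω := by
  rw [blockVar, blockVar, blockMean_congr h,
    blockMean_congr (f := fun η => f η ^ 2) (g := fun η => g η ^ 2) fun ω' hω' => by
      simp only [h ω' hω']]

theorem blockVar_const_mul (A : Finset (Vertex k)) (a : ℝ) (f : Config k → ℝ) (ω : Config k) :
    blockVar p A (fun η => a * f η) ω = a ^ 2 * blockVar p A f ω := by
  simp only [blockVar, mul_pow, blockMean_const_mul]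
  ring

theorem blockVar_eq_zero {A : Finset (Vertex k)} {f : Config k → ℝ} {ω : Config k}
    (h : ∀ ω', AgreeOff A ω ω' → f ω' = f ω) : blockVar p A f ω = 0 := by
  rw [blockVar, blockMean_eq_self h, blockMean_eq_self (f := fun η => f η ^ 2) fun ω' hω' => by
      simp only [h ω' hω'], sub_self]

theorem blockMean_sub_sq {A : Finset (Vertex k)} (f : Config k → ℝ) {h : Config k → ℝ}
    {ω : Config k} (hh : ∀ ω', AgreeOff A ω ω' → h ω' = h ω) :
    blockMean p A (fun η => (f η - h η) ^ 2) ω =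
      blockVar p A f ω + (blockMean p A f ω - h ω) ^ 2 := by
  have e : blockMean p A (fun η => (f η - h η) ^ 2) ω =
      blockMean p A (fun η => f η ^ 2 + ((-2 * h ω) * f η + h ω ^ 2)) ω :=
    blockMean_congr fun ω' hω' => by simp only [hh ω' hω']; ring
  rw [e, blockMean_add, blockMean_add, blockMean_const_mul, blockMean_const, blockVar]
  ring

theorem blockVar_le_sub_sq {A : Finset (Vertex k)} (f : Config k → ℝ) {h : Config k → ℝ}
    {ω : Config k} (hh : ∀ ω', AgreeOff A ω ω' → h ω' = h ω) :
    blockVar p A f ω ≤ blockMean p A (fun η => (f η - h η) ^ 2) ω := by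
  rw [blockMean_sub_sq f hh]
  linarith [sq_nonneg (blockMean p A f ω - h ω)]

theorem blockVar_eq_sub_sq (A : Finset (Vertex k)) (f : Config k → ℝ) (ω : Config k) :
    blockVar p A f ω = blockMean p A (fun η => (f η - blockMean p A f η) ^ 2) ω := by
  rw [blockMean_sub_sq f fun ω' hω' => blockMean_fibre A f hω']
  simp

theorem blockVar_le_sq (A : Finset (Vertex k)) (f : Config k → ℝ) (ω : Config k) :
    blockVar p A f ω ≤ blockMean p A (fun η => f η ^ 2) ω := by
  rw [blockVar]; linarith [sq_nonneg (blockMean p A f ω)]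

/-- The law of total variance. -/
theorem blockVar_union (A B : Finset (Vertex k)) (f : Config k → ℝ) (ω : Config k) :
    blockVar p (A ∪ B) f ω =
      blockMean p A (blockVar p B f) ω + blockVar p A (blockMean p B f) ω := by
  have e : blockVar p B f = fun η => blockMean p B (fun η => f η ^ 2) η - blockMean p B f η ^ 2 :=
    rfl
  rw [e, blockMean_sub, blockMean_blockMean, blockVar, blockVar, blockMean_blockMean]
  ring

/-- Convexity of the variance: centring over `A` commutes with averaging over `B`, and Jensen does
the rest. -/
theorem blockVar_blockMean_le (A B : Finset (Vertex k)) (f : Config k → ℝ) (ω : Config k) :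
    blockVar p A (blockMean p B f) ω ≤ blockMean p B (blockVar p A f) ω := by
  have e : blockVar p A f = blockMean p A (fun η => (f η - blockMean p A f η) ^ 2) :=
    funext fun η => blockVar_eq_sub_sq A f η
  rw [e, blockMean_comm, blockVar_eq_sub_sq, blockMean_comm]
  refine blockMean_mono (fun η => ?_) A ω
  rw [← blockMean_sub]
  exact blockMean_sq_le B _ η

theorem blockVar_blockMean_fibre {A B : Finset (Vertex k)} {f : Config k → ℝ} {ω ω' : Config k}
    (h : AgreeOff (A ∪ B) ω ω') :
    blockVar p A (blockMean p B f) ω' = blockVar p A (blockMean p B f) ω := by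
  have e : (fun η => blockMean p B f η ^ 2) = blockMean p B fun η => blockMean p B f η ^ 2 :=
    funext fun η => (blockMean_eq_self (f := fun η => blockMean p B f η ^ 2) fun η' hη => by
      simp only [blockMean_fibre B f hη]).symm
  rw [blockVar, blockVar, e, blockMean_blockMean, blockMean_blockMean, blockMean_fibre _ _ h,
    blockMean_fibre _ _ h]

/-- Young's inequality for variances, with the constants used below. -/
theorem blockVar_add_le (A : Finset (Vertex k)) (f g : Config k → ℝ) (ω : Config k) :
    blockVar p A (fun η => f η + g η) ω ≤ 9 * blockVar p A f ω + 9 / 8 * blockVar p A g ω := by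
  rw [blockVar_eq_sub_sq A f, blockVar_eq_sub_sq A g, ← blockMean_const_mul, ← blockMean_const_mul,
    ← blockMean_add, blockVar_eq_sub_sq]
  refine blockMean_mono (fun η => ?_) A ω
  rw [blockMean_add]
  nlinarith [sq_nonneg (8 * (f η - blockMean p A f η) - (g η - blockMean p A g η))]

theorem blockVar_add_le_two (A : Finset (Vertex k)) (f g : Config k → ℝ) (ω : Config k) :
    blockVar p A (fun η => f η + g η) ω ≤ 2 * blockVar p A f ω + 2 * blockVar p A g ω := by
  rw [blockVar_eq_sub_sq A f, blockVar_eq_sub_sq A g, ← blockMean_const_mul, ← blockMean_const_mul,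
    ← blockMean_add, blockVar_eq_sub_sq]
  refine blockMean_mono (fun η => ?_) A ω
  rw [blockMean_add]
  nlinarith [sq_nonneg ((f η - blockMean p A f η) - (g η - blockMean p A g η))]

/-! ### The martingale decomposition from the root downwards -/

/-- An enumeration key that lists the vertices level by level. -/
def rank (x : Vertex k) : ℕ ×ₗ ℕ := toLex (x.length, Encodable.encode x)

theorem rank_injective : Function.Injective (rank (k := k)) := fun x y h => by
  simpa [rank] using (Prod.ext_iff.1 (toLex.injective h)).2

theorem rank_lt_of_length_lt {x y : Vertex k} (h : x.length < y.length) : rank x < rank y :=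
  Prod.Lex.toLex_lt_toLex.2 (Or.inl h)

/-- The vertices of `A` that come after `x`. -/
def after (A : Finset (Vertex k)) (x : Vertex k) : Finset (Vertex k) :=
  A.filter fun y => rank x < rank y

theorem mem_after {A : Finset (Vertex k)} {x y : Vertex k} :
    y ∈ after A x ↔ y ∈ A ∧ rank x < rank y := Finset.mem_filter

theorem after_subset (A : Finset (Vertex k)) (x : Vertex k) : after A x ⊆ A :=
  Finset.filter_subset _ _

theorem notMem_after_self (A : Finset (Vertex k)) (x : Vertex k) : x ∉ after A x := fun h =>
  lt_irrefl _ (mem_after.1 h).2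

/-- Adding a vertex that precedes all the others, the law of total variance splits off its
increment, and the sets `after` of the later vertices do not change. -/
theorem blockVar_eq_sum (A : Finset (Vertex k)) (f : Config k → ℝ) (ω : Config k) :
    blockVar p A f ω =
      ∑ x ∈ A, blockMean p A (blockVar p {x} (blockMean p (after A x) f)) ω := by
  induction A using Finset.induction_on_min_value rank generalizing ω with
  | empty => simp [blockVar]
  | insert a s ha hmin ih =>
    have hlt : ∀ x ∈ s, rank a < rank x := fun x hx =>
      lt_of_le_of_ne (hmin x hx) fun h => ha (rank_injective h ▸ hx)
    have h1 : after (insert a s) a = s := by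
      ext y
      simp only [mem_after, Finset.mem_insert]
      constructor
      · rintro ⟨rfl | h, h'⟩
        · exact absurd h' (lt_irrefl _)
        · exact h
      · exact fun h => ⟨Or.inr h, hlt y h⟩
    have h2 : ∀ x ∈ s, after (insert a s) x = after s x := fun x hx => by
      ext y
      simp only [mem_after, Finset.mem_insert]
      constructor
      · rintro ⟨rfl | h, h'⟩
        · exact absurd h' (hlt x hx).not_gt
        · exact ⟨h, h'⟩
      · exact fun h => ⟨Or.inr h.1, h.2⟩
    rw [Finset.sum_insert ha, h1, Finset.insert_eq, blockVar_union, funext ih, blockMean_sum,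
      add_comm]
    congr 1
    · symm
      exact blockMean_eq_self fun ω' hω' => blockVar_blockMean_fibre hω'
    · refine Finset.sum_congr rfl fun x hx => ?_
      rw [blockMean_blockMean, ← Finset.insert_eq, h2 x hx]

/-! ### Dependence on coordinates -/

theorem agreeOff_of_dependsOn {β : Type*} {f : Config k → β} {U A : Finset (Vertex k)}
    (h : DependsOn f (U : Set (Vertex k))) (hd : Disjoint A U) {ω ω' : Config k}
    (hω : AgreeOff A ω ω') : f ω' = f ω :=
  h fun v hv => hω v fun hA => Finset.disjoint_left.1 hd hA hv

theorem blockMean_invariant {C : Finset (Vertex k)} {g : Config k → ℝ}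
    (h : ∀ ω ω', AgreeOff C ω ω' → g ω' = g ω) (B : Finset (Vertex k)) {ω ω' : Config k}
    (hω : AgreeOff C ω ω') : blockMean p B g ω' = blockMean p B g ω := by
  have e : blockMean p C g = g := funext fun ω => blockMean_eq_self fun ω' hω' => h ω ω' hω'
  rw [← e, blockMean_comm, blockMean_fibre _ _ hω]

theorem blockMean_dependsOn {f : Config k → ℝ} {S : Set (Vertex k)} (h : DependsOn f S)
    (A : Finset (Vertex k)) : DependsOn (blockMean p A f) (S \ A) := by
  have key : DependsOn (blockMean p A f) S := by
    induction A using Finset.induction_on with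
    | empty => simpa using h
    | insert x A _ ih =>
      intro ω ω' hω
      have : ∀ b, blockMean p A f (Function.update ω x b) =
          blockMean p A f (Function.update ω' x b) := fun b => ih fun v hv => by
        rcases eq_or_ne v x with rfl | hx
        · simp
        · simp [Function.update_of_ne hx, hω v hv]
      rw [blockMean_insert, siteMean_eq, siteMean_eq, this, this]
  intro ω ω' hω
  -- The hybrid configuration agrees with `ω'` off `A` and with `ω` on all of `S`.
  have h1 : blockMean p A f (A.piecewise ω ω') = blockMean p A f ω' :=
    blockMean_fibre A f fun v hv => by simp [hv]
  rw [← h1]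
  refine key fun v hv => ?_
  by_cases hA : v ∈ A
  · simp [hA]
  · simpa [hA] using hω v ⟨hv, hA⟩

theorem blockMean_eq_of_dependsOn {f : Config k → ℝ} {U A : Finset (Vertex k)}
    (h : DependsOn f (U : Set (Vertex k))) (hUA : U ⊆ A) (ω ω' : Config k) :
    blockMean p A f ω = blockMean p A f ω' :=
  blockMean_dependsOn h A fun _ hv => absurd (hUA hv.1) hv.2

theorem blockMean_eq_of_dependsOn_subset {f : Config k → ℝ} {U A : Finset (Vertex k)}
    (h : DependsOn f (U : Set (Vertex k))) (hUA : U ⊆ A) (ω : Config k) :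
    blockMean p A f ω = blockMean p U f ω := by
  rw [← blockMean_of_subset hUA]
  exact blockMean_eq_self fun ω' _ => blockMean_eq_of_dependsOn h subset_rfl ω' ω

theorem blockMean_mul_of_dependsOn {f g : Config k → ℝ} {U W A : Finset (Vertex k)}
    (hf : DependsOn f (U : Set (Vertex k))) (hg : DependsOn g (W : Set (Vertex k)))
    (hd : Disjoint U W) (hWA : W ⊆ A) (ω : Config k) :
    blockMean p A (fun η => f η * g η) ω = blockMean p A f ω * blockMean p A g ω := by
  rw [← blockMean_of_subset hWA]
  have e : blockMean p W (fun η => f η * g η) = fun η => blockMean p W g ω * f η :=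
      funext fun η => by
    rw [blockMean_mul_left fun η' hη' => agreeOff_of_dependsOn hf hd.symm hη',
      blockMean_eq_of_dependsOn hg subset_rfl η ω, mul_comm]
  rw [e, blockMean_const_mul, blockMean_eq_of_dependsOn_subset hg hWA, mul_comm]

/-! ### A Poincaré inequality for long-range constraints -/

section LongRange

variable {A U : Finset (Vertex k)} {g c : Config k → ℝ} {x : Vertex k}

/-- This controls the error made by inserting the constraint. Since `c` is seen only by `U`, the
other later coordinates can be averaged out of `g` first; Cauchy–Schwarz on `U` then trades `1 - c`
for its probability `η`. -/
theorem blockVar_blockMean_constraint_le {η : ℝ} (hU : U ⊆ after A x)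
    (hc : ∀ ω, c ω = 0 ∨ c ω = 1) (hcU : DependsOn c (U : Set (Vertex k)))
    (hη : ∀ ω, blockMean p A (fun ω' => 1 - c ω') ω ≤ η) (ω : Config k) :
    blockVar p {x} (blockMean p (after A x) fun ω' => (1 - c ω') * g ω') ω ≤
      η * blockVar p (insert x U) (blockMean p (after A x \ U) g) ω := by
  have hxU : x ∉ U := fun h => notMem_after_self A x (hU h)
  have hcU1 : DependsOn (fun ω => 1 - c ω) (U : Set (Vertex k)) := fun a b hab => by
    simp only [hcU hab]
  set h := blockMean p (after A x \ U) g with hh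
  set m := blockMean p (insert x U) h with hm
  have e1 : blockMean p (after A x) (fun ω' => (1 - c ω') * g ω') =
      blockMean p U fun ω' => (1 - c ω') * h ω' := by
    conv_lhs => rw [← Finset.union_sdiff_of_subset hU, ← blockMean_blockMean]
    refine funext fun ω₁ => blockMean_congr fun ω' _ => ?_
    exact blockMean_mul_left (fun ω'' hω => agreeOff_of_dependsOn hcU1 Finset.sdiff_disjoint hω) g
  have hinv : ∀ ω' ω'', AgreeOff {x} ω' ω'' → (1 - c ω'') * m ω'' = (1 - c ω') * m ω' := by
    intro ω' ω'' hω
    rw [agreeOff_of_dependsOn hcU (by simpa using hxU) hω,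
      hm, blockMean_fibre (insert x U) h (hω.mono (by simp))]
  have hU_eta : ∀ ω, blockMean p U (fun ω' => (1 - c ω') ^ 2) ω ≤ η := fun ω => by
    refine le_trans (le_of_eq ?_) (hη ω)
    rw [blockMean_eq_of_dependsOn_subset hcU1 (hU.trans (after_subset A x))]
    exact blockMean_congr fun ω' _ => by rcases hc ω' with h | h <;> simp [h]
  rw [e1]
  -- The subtracted function is free of `x`, which is all that is needed to bound a variance over
  -- `x`; choosing the mean `m` over `insert x U` produces a variance on the right.
  refine (blockVar_le_sub_sq _ (h := blockMean p U fun ω' => (1 - c ω') * m ω')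
    fun ω' hω => blockMean_invariant hinv U hω).trans ?_
  rw [blockVar_eq_sub_sq, Finset.insert_eq, ← blockMean_blockMean, ← blockMean_const_mul,
    ← Finset.insert_eq]
  refine blockMean_mono (fun ω' => ?_) _ ω
  rw [← blockMean_sub]
  have e2 : (fun η => (1 - c η) * h η - (1 - c η) * m η) = fun η => (1 - c η) * (h η - m η) := by
    ext; ring
  rw [e2]
  refine (blockMean_mul_le U _ _ ω').trans ?_
  exact mul_le_mul_of_nonneg_right (hU_eta ω') (blockMean_nonneg (fun _ => sq_nonneg _) ω')

/-- In the martingale decomposition over `insert x U`, the increment at `y` averages over a set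
containing `after A y`, so by convexity it is at most the increment of `g` itself. -/
theorem blockMean_blockVar_insert_le (hx : x ∈ A) (hU : U ⊆ after A x) (ω : Config k) :
    blockMean p A (blockVar p (insert x U) (blockMean p (after A x \ U) g)) ω ≤
      ∑ y ∈ insert x U, blockMean p A (blockVar p {y} (blockMean p (after A y) g)) ω := by
  have hUA : insert x U ⊆ A := Finset.insert_subset hx (hU.trans (after_subset A x))
  rw [funext (blockVar_eq_sum (p := p) (insert x U) _), blockMean_sum]
  refine Finset.sum_le_sum fun y hy => ?_
  rw [blockMean_of_subset hUA, blockMean_blockMean]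
  set C := after (insert x U) y ∪ after A x \ U with hC
  have hxy : rank x ≤ rank y := by
    rcases Finset.mem_insert.1 hy with rfl | h
    · exact le_rfl
    · exact (mem_after.1 (hU h)).2.le
  have hCA : C ⊆ A := Finset.union_subset ((after_subset _ _).trans hUA)
    (Finset.sdiff_subset.trans (after_subset _ _))
  have hsub : after A y ⊆ C := fun z hz => by
    rw [mem_after] at hz
    simp only [hC, Finset.mem_union, mem_after, Finset.mem_sdiff, Finset.mem_insert]
    by_cases hzU : z ∈ U
    · exact Or.inl ⟨Or.inr hzU, hz.2⟩
    · exact Or.inr ⟨⟨hz.1, hxy.trans_lt hz.2⟩, hzU⟩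
  rw [← blockMean_of_subset hsub g, ← blockMean_of_subset hCA (blockVar p {y}
    (blockMean p (after A y) g))]
  exact blockMean_mono (fun ω' => blockVar_blockMean_le _ _ _ ω') A ω

end LongRange

/-- Each increment is split by `g = c g + (1 - c) g`. The error at `x` is at most `η` times the
increments over `insert x (U x)`, and every vertex is charged at most `N` times. The errors thus
total at most `9/8 * 4/5 = 9/10` of the variance and are absorbed, which turns the factor `9` into
`90`. -/
theorem blockVar_le_sum_constraint {A S : Finset (Vertex k)} (hSA : S ⊆ A) {g : Config k → ℝ}
    (hg : ∀ ω ω', AgreeOff (A \ S) ω ω' → g ω' = g ω) {U : Vertex k → Finset (Vertex k)}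
    (hU : ∀ x ∈ S, U x ⊆ after A x) {c : Vertex k → Config k → ℝ}
    (hc : ∀ x ω, c x ω = 0 ∨ c x ω = 1) (hcU : ∀ x ∈ S, DependsOn (c x) (U x : Set (Vertex k)))
    {η : ℝ} (hη0 : 0 ≤ η) (hη : ∀ x ∈ S, ∀ ω, blockMean p A (fun ω' => 1 - c x ω') ω ≤ η) {N : ℕ}
    (hN : ∀ y ∈ S, (S.filter fun x => y ∈ insert x (U x)).card ≤ N) (hηN : η * N ≤ 4 / 5)
    (ω : Config k) :
    blockVar p A g ω ≤ 90 * ∑ x ∈ S, blockMean p A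
      (blockVar p {x} (blockMean p (after A x) fun ω' => c x ω' * g ω')) ω := by
  set V : Vertex k → ℝ := fun y =>
    blockMean p A (blockVar p {y} (blockMean p (after A y) g)) ω with hV
  set X : Vertex k → ℝ := fun x => blockMean p A
      (blockVar p {x} (blockMean p (after A x) fun ω' => c x ω' * g ω')) ω with hX
  have hV0 : ∀ y, 0 ≤ V y := fun y => blockMean_nonneg (fun _ => blockVar_nonneg _ _ _) ω
  have hVout : ∀ y ∈ A, y ∉ S → V y = 0 := fun y hy hyS => by
    have : blockVar p {y} (blockMean p (after A y) g) = fun _ => 0 := funext fun ω' =>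
      blockVar_eq_zero fun ω'' hω => blockMean_invariant hg _
        (hω.mono (by simp [hy, hyS]))
    simp only [hV, this, blockMean_const]
  have hsum : blockVar p A g ω = ∑ x ∈ S, V x := by
    rw [blockVar_eq_sum]
    exact (Finset.sum_subset hSA hVout).symm
  have hstep : ∀ x ∈ S, V x ≤ 9 * X x + 9 / 8 * (η * ∑ y ∈ S with y ∈ insert x (U x), V y) := by
    intro x hx
    have hxA := hSA hx
    have e : blockMean p (after A x) g = fun ω' =>
        blockMean p (after A x) (fun ω' => c x ω' * g ω') ω' +
        blockMean p (after A x) (fun ω' => (1 - c x ω') * g ω') ω' := funext fun ω' => by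
      rw [← blockMean_add]
      exact blockMean_congr fun ω₁ _ => by ring
    have h1 : V x ≤ 9 * X x + 9 / 8 * blockMean p A (blockVar p {x}
        (blockMean p (after A x) (fun ω' => (1 - c x ω') * g ω'))) ω := by
      simp only [hV, hX, ← blockMean_const_mul, ← blockMean_add]
      rw [e]
      exact blockMean_mono (fun ω' => blockVar_add_le _ _ _ ω') A ω
    have h2 := blockMean_mono (p := p) (fun ω' => blockVar_blockMean_constraint_le (g := g) (hU x hx)
      (hc x) (hcU x hx) (hη x hx) ω') A ω
    rw [blockMean_const_mul] at h2
    have h3 := blockMean_blockVar_insert_le (p := p) (g := g) hxA (hU x hx) ω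
    have h4 : ∑ y ∈ insert x (U x), V y = ∑ y ∈ S with y ∈ insert x (U x), V y := by
      have hUA : insert x (U x) ⊆ A :=
        Finset.insert_subset hxA ((hU x hx).trans (after_subset A x))
      symm
      refine Finset.sum_subset (fun y hy => (Finset.mem_filter.1 hy).2) fun y hy hyn => ?_
      exact hVout y (hUA hy) fun hyS => hyn (Finset.mem_filter.2 ⟨hyS, hy⟩)
    rw [← h4]
    have h5 := mul_le_mul_of_nonneg_left h3 hη0
    simp only [hV] at *
    linarith
  have hswap : ∑ x ∈ S, ∑ y ∈ S with y ∈ insert x (U x), V y ≤ N * ∑ y ∈ S, V y := by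
    simp only [Finset.sum_filter]
    rw [Finset.sum_comm, Finset.mul_sum]
    refine Finset.sum_le_sum fun y hy => ?_
    rw [← Finset.sum_filter, Finset.sum_const, nsmul_eq_mul]
    exact mul_le_mul_of_nonneg_right (by exact_mod_cast hN y hy) (hV0 y)
  have htot := Finset.sum_le_sum hstep
  rw [Finset.sum_add_distrib, ← Finset.mul_sum, ← Finset.mul_sum, ← Finset.mul_sum] at htot
  have h6 := mul_le_mul_of_nonneg_left hswap hη0
  have hS0 : 0 ≤ ∑ y ∈ S, V y := Finset.sum_nonneg fun y _ => hV0 y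
  have h7 := mul_le_mul_of_nonneg_right hηN hS0
  rw [hsum]
  rw [← mul_assoc] at h6
  linarith

/-! ### Averages over random regions -/

/-- A region that can be determined without looking at the coordinates inside it. -/
def IsExplored (R : Config k → Finset (Vertex k)) : Prop :=
  ∀ ω ω', AgreeOff (R ω) ω ω' → R ω' = R ω

/-- A spatial strong Markov property: for fixed `C`, the event `D = C` does not involve the
coordinates in `C`, so conditioning on it leaves their product law intact. -/
theorem blockMean_explored {D : Config k → Finset (Vertex k)} (hD : IsExplored D)
    {A : Finset (Vertex k)} (hDA : ∀ ω, D ω ⊆ A) (φ : Config k → ℝ) (ω : Config k) :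
    blockMean p A (fun ω' => blockMean p (D ω') φ ω') ω = blockMean p A φ ω := by
  classical
  have e1 : (fun ω' => blockMean p (D ω') φ ω') = fun ω' => ∑ C ∈ A.powerset,
      blockMean p C (fun η => (if D η = C then 1 else 0) * φ η) ω' := funext fun ω' => by
    rw [Finset.sum_eq_single (D ω')]
    · refine blockMean_congr fun ω'' hω => ?_
      simp [hD _ _ hω]
    · intro C _ hC
      rw [blockMean_congr (g := fun _ => 0), blockMean_const]
      intro ω'' hω
      rw [if_neg, zero_mul]
      rintro rfl
      exact hC (hD ω'' ω' fun v hv => (hω v hv).symm).symm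
    · exact fun h => absurd (Finset.mem_powerset.2 (hDA ω')) h
  have e2 : φ = fun ω' => ∑ C ∈ A.powerset, (if D ω' = C then 1 else 0) * φ ω' :=
    funext fun ω' => by
      rw [← Finset.sum_mul, Finset.sum_ite_eq, if_pos (Finset.mem_powerset.2 (hDA ω')), one_mul]
  rw [e1, blockMean_sum]
  conv_rhs => rw [e2, blockMean_sum]
  exact Finset.sum_congr rfl fun C hC => by rw [blockMean_of_subset (Finset.mem_powerset.1 hC)]

/-- Membership of `x` in the region is determined by the coordinates after `x`. -/
def IsOriented (A : Finset (Vertex k)) (R : Config k → Finset (Vertex k)) : Prop :=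
  ∀ x ∈ A, ∀ ω ω', (∀ v ∈ after A x, ω v = ω' v) → (x ∈ R ω ↔ x ∈ R ω')

/-- This converts the constrained increments into a variance inside the random region. On `x ∈ R`
the average over `after A x` can start with the average over `after R x`, because `R` is explored;
by orientation, membership of `x` and the set `after R x` are unaffected by the variable at `x`.
What appears is the increment at `x` in the decomposition over `R`. -/
theorem sum_blockVar_indicator_le {A S : Finset (Vertex k)} (hSA : S ⊆ A)
    {R : Config k → Finset (Vertex k)} (hR : IsExplored R) (hRA : ∀ ω, R ω ⊆ A)
    (hRo : IsOriented A R) (g : Config k → ℝ) (ω : Config k) :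
    ∑ x ∈ S, blockMean p A (blockVar p {x} (blockMean p (after A x) fun ω' =>
      (if x ∈ R ω' then 1 else 0) * g ω')) ω ≤
    blockMean p A (fun ω' => blockVar p (R ω') g ω') ω := by
  have hD : ∀ x, IsExplored fun ω => after (R ω) x := fun x ω ω' h => by
    simp only [hR ω ω' (h.mono (after_subset _ _))]
  set Φ : Vertex k → Config k → ℝ := fun x ω' =>
    (if x ∈ R ω' then 1 else 0) * blockVar p {x} (blockMean p (after (R ω') x) g) ω' with hΦ
  have hΦ0 : ∀ x ω', 0 ≤ Φ x ω' := fun x ω' =>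
    mul_nonneg (by split_ifs <;> simp) (blockVar_nonneg _ _ _)
  have hrhs : blockMean p A (fun ω' => blockVar p (R ω') g ω') ω =
      ∑ x ∈ A, blockMean p A (Φ x) ω := by
    rw [← blockMean_sum]
    have : ∀ ω', blockVar p (R ω') g ω' = ∑ x ∈ A, blockMean p (R ω') (Φ x) ω' := fun ω' => by
      rw [blockVar_eq_sum, ← Finset.sum_subset (hRA ω')]
      · refine Finset.sum_congr rfl fun x hx => blockMean_congr fun ω'' hω => ?_
        simp [hΦ, hR _ _ hω, hx]
      · intro x _ hx
        rw [blockMean_congr (g := fun _ => 0), blockMean_const]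
        intro ω'' hω
        simp [hΦ, hR _ _ hω, hx]
    rw [funext this, blockMean_sum, blockMean_sum]
    exact Finset.sum_congr rfl fun x _ => blockMean_explored hR hRA _ ω
  rw [hrhs]
  refine (Finset.sum_le_sum fun x hx => ?_).trans (Finset.sum_le_sum_of_subset_of_nonneg hSA
    fun x _ _ => blockMean_nonneg (hΦ0 x) ω)
  have hxA := hSA hx
  have e : blockMean p (after A x) (fun ω' => (if x ∈ R ω' then 1 else 0) * g ω') =
      blockMean p (after A x) fun ω' =>
        (if x ∈ R ω' then 1 else 0) * blockMean p (after (R ω') x) g ω' := funext fun ω' => by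
    rw [← blockMean_explored (hD x) fun ω' y hy =>
      mem_after.2 ⟨hRA ω' (mem_after.1 hy).1, (mem_after.1 hy).2⟩]
    refine blockMean_congr fun ω'' _ => ?_
    refine blockMean_mul_left (g := fun η => if x ∈ R η then (1 : ℝ) else 0) (fun η hη => ?_) _
    simp only [hR _ _ (hη.mono (after_subset _ _))]
  have e2 : blockVar p {x} (fun ω' =>
      (if x ∈ R ω' then 1 else 0) * blockMean p (after (R ω') x) g ω') = Φ x := funext fun ω' => by
    -- Changing the variable at `x` cannot alter membership of `x` or of later vertices, since
    -- neither decision looks at `x`.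
    have hmem : ∀ ω'', AgreeOff {x} ω' ω'' → ∀ y ∈ A, rank x ≤ rank y →
        (y ∈ R ω'' ↔ y ∈ R ω') := fun ω'' hω y hy hxy =>
      hRo y hy ω'' ω' fun v hv => hω v fun hvx => by
        rw [Finset.mem_singleton.1 hvx] at hv
        exact hxy.not_gt (mem_after.1 hv).2
    rw [blockVar_congr (g := fun ω'' =>
      (if x ∈ R ω' then 1 else 0) * blockMean p (after (R ω') x) g ω''), blockVar_const_mul]
    · simp only [hΦ]
      split_ifs <;> simp
    · intro ω'' hω
      have h1 : after (R ω'') x = after (R ω') x := by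
        ext y
        simp only [mem_after]
        constructor
        · exact fun h => ⟨(hmem ω'' hω y (hRA _ h.1) h.2.le).1 h.1, h.2⟩
        · exact fun h => ⟨(hmem ω'' hω y (hRA _ h.1) h.2.le).2 h.1, h.2⟩
      simp only [h1, hmem ω'' hω x hxA le_rfl]
  rw [e, ← e2, ← blockMean_of_subset (after_subset A x) (blockVar p {x} fun ω' =>
    (if x ∈ R ω' then 1 else 0) * blockMean p (after (R ω') x) g ω')]
  exact blockMean_mono (fun ω' => blockVar_blockMean_le _ _ _ ω') A ω

/-- The variance over `A` is the part from `A \ S` plus the variance of `g = blockMean p (A \ S) f`.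
The second part costs `90` times the variance of `g` over `R`, and replacing `g` by `f` there
doubles both terms, whence `180` and `181 = 1 + 180`. -/
theorem blockVar_two_block {A S : Finset (Vertex k)} (hSA : S ⊆ A)
    {R : Config k → Finset (Vertex k)} (hR : IsExplored R) (hRA : ∀ ω, R ω ⊆ A)
    (hRo : IsOriented A R) {U : Vertex k → Finset (Vertex k)} (hU : ∀ x ∈ S, U x ⊆ after A x)
    {c : Vertex k → Config k → ℝ} (hc : ∀ x ω, c x ω = if x ∈ R ω then 1 else 0)
    (hcU : ∀ x ∈ S, DependsOn (c x) (U x : Set (Vertex k)))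
    {η : ℝ} (hη0 : 0 ≤ η) (hη : ∀ x ∈ S, ∀ ω, blockMean p A (fun ω' => 1 - c x ω') ω ≤ η) {N : ℕ}
    (hN : ∀ y ∈ S, (S.filter fun x => y ∈ insert x (U x)).card ≤ N) (hηN : η * N ≤ 4 / 5)
    (f : Config k → ℝ) (ω : Config k) :
    blockVar p A f ω ≤ 181 * blockMean p A (blockVar p (A \ S) f) ω +
      180 * blockMean p A (fun ω' => blockVar p (R ω') f ω') ω := by
  set g := blockMean p (A \ S) f with hg
  have hc01 : ∀ x ω, c x ω = 0 ∨ c x ω = 1 := fun x ω => by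
    rw [hc]; split_ifs <;> simp
  have h1 := blockVar_le_sum_constraint hSA (g := g) (fun ω ω' h => blockMean_fibre _ _ h) hU hc01 hcU
    hη0 hη hN hηN ω
  have h2 : ∑ x ∈ S, blockMean p A
      (blockVar p {x} (blockMean p (after A x) fun ω' => c x ω' * g ω')) ω ≤
      blockMean p A (fun ω' => blockVar p (R ω') g ω') ω := by
    simp only [hc]
    exact sum_blockVar_indicator_le hSA hR hRA hRo g ω
  have h3 : blockMean p A (fun ω' => blockVar p (R ω') g ω') ω ≤
      2 * blockMean p A (fun ω' => blockVar p (R ω') f ω') ω +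
        2 * blockMean p A (blockVar p (A \ S) f) ω := by
    -- After the average over `A`, the inner average over `R` is invisible, so the squared error `f
    -- - g` does not depend on the region.
    have e : blockMean p A (blockVar p (A \ S) f) ω =
        blockMean p A (fun ω' => blockMean p (R ω') (fun ω' => (f ω' - g ω') ^ 2) ω') ω := by
      rw [blockMean_explored hR hRA, funext (blockVar_eq_sub_sq (A \ S) f),
        blockMean_of_subset Finset.sdiff_subset]
    rw [e, ← blockMean_const_mul, ← blockMean_const_mul, ← blockMean_add]
    refine blockMean_mono (fun ω' => ?_) A ω
    have h4 := blockVar_add_le_two (p := p) (R ω') f (fun η => g η - f η) ω'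
    have h5 := blockVar_le_sq (p := p) (R ω') (fun η => g η - f η) ω'
    have e1 : (fun η => f η + (g η - f η)) = g := by ext; ring
    have e2 : (fun η => (g η - f η) ^ 2) = fun η => (f η - g η) ^ 2 := by ext; ring
    rw [e1] at h4
    rw [e2] at h5
    linarith
  have h6 : blockVar p A f ω = blockMean p A (blockVar p (A \ S) f) ω + blockVar p A g ω := by
    rw [hg, ← blockVar_union, Finset.union_eq_left.2 Finset.sdiff_subset]
  linarith

/-! ### Occupied paths and the region explored from below -/

/-- There is an occupied path of length `d` in `A` that starts from a child of `x`. -/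
def Reach (A : Finset (Vertex k)) : ℕ → Vertex k → Config k → Prop
  | 0, _, _ => True
  | d + 1, x, ω => ∃ i : Fin k, i :: x ∈ A ∧ ω (i :: x) = true ∧ Reach A d (i :: x) ω

/-- The strict descendants of `x` in `A`. -/
def below (A : Finset (Vertex k)) (x : Vertex k) : Finset (Vertex k) :=
  A.filter fun y => x <:+ y ∧ x.length < y.length

theorem mem_below {A : Finset (Vertex k)} {x y : Vertex k} :
    y ∈ below A x ↔ y ∈ A ∧ x <:+ y ∧ x.length < y.length := Finset.mem_filter

theorem below_subset (A : Finset (Vertex k)) (x : Vertex k) : below A x ⊆ A :=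
  Finset.filter_subset _ _

theorem below_subset_after {A A' : Finset (Vertex k)} (h : A ⊆ A') (x : Vertex k) :
    below A x ⊆ after A' x := fun _ hy =>
  mem_after.2 ⟨h (mem_below.1 hy).1, rank_lt_of_length_lt (mem_below.1 hy).2.2⟩

theorem child_mem_below {A : Finset (Vertex k)} {x : Vertex k} {i : Fin k} (h : i :: x ∈ A) :
    i :: x ∈ below A x := mem_below.2 ⟨h, List.suffix_cons i x, by simp⟩

theorem below_child_subset (A : Finset (Vertex k)) (x : Vertex k) (i : Fin k) :
    below A (i :: x) ⊆ below A x := fun y hy => by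
  obtain ⟨h1, h2, h3⟩ := mem_below.1 hy
  exact mem_below.2 ⟨h1, (List.suffix_cons i x).trans h2, by simp at h3; omega⟩

theorem reach_dependsOn (A : Finset (Vertex k)) (d : ℕ) (x : Vertex k) :
    DependsOn (Reach A d x) (below A x : Set (Vertex k)) := by
  induction d generalizing x with
  | zero => exact fun _ _ _ => rfl
  | succ d ih =>
    intro ω ω' hω
    refine propext (exists_congr fun i => and_congr_right fun hi => ?_)
    rw [hω _ (child_mem_below hi), ih (i :: x) fun v hv => hω v (below_child_subset A x i hv)]

open scoped Classical in
/-- The vertices of `A` above level `M` from which level `M` is not reached. -/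
noncomputable def explored (A : Finset (Vertex k)) (M : ℕ) (ω : Config k) : Finset (Vertex k) :=
  A.filter fun y => y.length < M ∧ ¬ Reach A (M - y.length) y ω

theorem mem_explored {A : Finset (Vertex k)} {M : ℕ} {ω : Config k} {y : Vertex k} :
    y ∈ explored A M ω ↔ y ∈ A ∧ y.length < M ∧ ¬ Reach A (M - y.length) y ω := by
  simp [explored]

theorem explored_subset (A : Finset (Vertex k)) (M : ℕ) (ω : Config k) : explored A M ω ⊆ A :=
  fun _ hy => (mem_explored.1 hy).1

theorem explored_isOriented {A A' : Finset (Vertex k)} (h : A ⊆ A') (M : ℕ) :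
    IsOriented A' (explored A M) := fun x _ ω ω' hω => by
  rw [mem_explored, mem_explored,
    reach_dependsOn A (M - x.length) x fun v hv => hω v (below_subset_after h x hv)]

/-- A vertex of the region cannot continue a path to level `M`, so its own state is irrelevant to
who reaches that level. -/
theorem explored_isExplored (A : Finset (Vertex k)) (M : ℕ) : IsExplored (explored A M) := by
  intro ω ω' hω
  have key : ∀ d (y : Vertex k), y.length + d = M → (Reach A d y ω' ↔ Reach A d y ω) := by
    intro d
    induction d with
    | zero => exact fun _ _ => Iff.rfl
    | succ d ih =>
      intro y hy
      refine exists_congr fun i => and_congr_right fun hi => ?_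
      rw [ih (i :: y) (by simp; omega)]
      -- Only children from which level `M` is reached matter; they lie outside the region, where
      -- the two configurations coincide.
      refine and_congr_left fun hr => ?_
      rw [hω (i :: y)]
      rw [mem_explored]
      rintro ⟨-, hlt, hn⟩
      refine hn ?_
      rwa [show M - (i :: y).length = d by simp; omega]
  ext y
  rw [mem_explored, mem_explored]
  refine and_congr_right fun _ => and_congr_right fun hlt => not_congr (key _ _ (by omega))

/-! ### Probability of a long occupied path. -/

theorem blockMean_prod {ι : Type*} [DecidableEq ι] {A : Finset (Vertex k)} (s : Finset ι)
    {W : ι → Finset (Vertex k)} {g : ι → Config k → ℝ}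
    (hg : ∀ i, DependsOn (g i) (W i : Set (Vertex k))) (hW : ∀ i, W i ⊆ A)
    (hd : ∀ i j, i ≠ j → Disjoint (W i) (W j)) (ω : Config k) :
    blockMean p A (fun η => ∏ i ∈ s, g i η) ω = ∏ i ∈ s, blockMean p A (g i) ω := by
  induction s using Finset.induction_on with
  | empty => simp [blockMean_const]
  | insert a s ha ih =>
    simp only [Finset.prod_insert ha]
    rw [blockMean_mul_of_dependsOn (hg a) (W := s.biUnion W) (g := fun η => ∏ i ∈ s, g i η), ih]
    · intro η η' h
      exact Finset.prod_congr rfl fun i hi => hg i fun v hv =>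
        h v (by simpa using ⟨i, hi, hv⟩)
    · exact (Finset.disjoint_biUnion_right _ _ _).2 fun i hi =>
        hd a i fun h => ha (h ▸ hi)
    · exact Finset.biUnion_subset.2 fun i _ => hW i

open scoped Classical in
/-- The indicator function of `Reach A d x`. -/
noncomputable def reachInd (A : Finset (Vertex k)) (d : ℕ) (x : Vertex k) (ω : Config k) : ℝ :=
  if Reach A d x ω then 1 else 0

theorem reachInd_dependsOn (A : Finset (Vertex k)) (d : ℕ) (x : Vertex k) :
    DependsOn (reachInd A d x) (below A x : Set (Vertex k)) := fun ω ω' h => by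
  have h' : Reach A d x ω = Reach A d x ω' := reach_dependsOn A d x h
  by_cases hr : Reach A d x ω
  · rw [reachInd, reachInd, if_pos hr, if_pos (h' ▸ hr)]
  · rw [reachInd, reachInd, if_neg hr, if_neg (h' ▸ hr)]

theorem disjoint_subtree (A : Finset (Vertex k)) (x : Vertex k) {i j : Fin k} (h : i ≠ j) :
    Disjoint (A.filter fun y => i :: x <:+ y) (A.filter fun y => j :: x <:+ y) := by
  refine Finset.disjoint_left.2 fun y hi hj => h ?_
  have h1 := (Finset.mem_filter.1 hi).2
  have h2 := (Finset.mem_filter.1 hj).2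
  have := (List.suffix_of_suffix_length_le h1 h2 (by simp)).eq_of_length (by simp)
  exact (List.cons.inj this).1

/-- The branching recursion: the subtrees of the `k` children are independent, and each carries the
path with probability at most `p * θ`. -/
theorem blockMean_reachInd_succ_le {A A' : Finset (Vertex k)} (hA : A ⊆ A') {d : ℕ} {θ : ℝ}
    (hθ0 : 0 ≤ θ) (hθ1 : θ ≤ 1) (h : ∀ x ω, blockMean p A' (reachInd A d x) ω ≤ θ)
    (x : Vertex k) (ω : Config k) :
    blockMean p A' (reachInd A (d + 1) x) ω ≤ 1 - (1 - p * θ) ^ k := by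
  classical
  have hp0 := p.2.1
  have hp1 := p.2.2
  set a : Fin k → Config k → ℝ := fun i η =>
    if i :: x ∈ A ∧ η (i :: x) = true ∧ Reach A d (i :: x) η then 1 else 0 with ha
  have e1 : reachInd A (d + 1) x = fun η => 1 - ∏ i, (1 - a i η) := by
    funext η
    by_cases hr : Reach A (d + 1) x η
    · obtain ⟨i, hi⟩ := id hr
      rw [reachInd, if_pos hr, Finset.prod_eq_zero (Finset.mem_univ i) (by simp [ha, hi]), sub_zero]
    · rw [reachInd, if_neg hr, Finset.prod_eq_one, sub_self]
      intro i _
      simp only [ha]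
      rw [if_neg fun hi => hr ⟨i, hi⟩, sub_zero]
  have hmean : ∀ i, blockMean p A' (a i) ω ≤ p * θ := by
    intro i
    by_cases hi : i :: x ∈ A
    · have e : a i = fun η => (if η (i :: x) = true then 1 else 0) * reachInd A d (i :: x) η := by
        funext η
        simp only [ha, reachInd, hi, true_and]
        split_ifs <;> simp_all
      have hdep : DependsOn (fun η : Config k => if η (i :: x) = true then (1 : ℝ) else 0)
          (({i :: x} : Finset (Vertex k)) : Set (Vertex k)) := fun η η' h => by
        simp only [h (i :: x) (by simp)]
      rw [e, blockMean_mul_of_dependsOn hdep (reachInd_dependsOn A d (i :: x))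
        (by simp [mem_below]) ((below_subset _ _).trans hA),
        blockMean_eq_of_dependsOn_subset hdep (by simpa using hA hi), blockMean_singleton,
        siteMean_eq]
      simpa using mul_le_mul_of_nonneg_left (h (i :: x) ω) hp0
    · have e : a i = fun _ => 0 := by
        funext η
        simp [ha, hi]
      rw [e, blockMean_const]
      positivity
  have hdep : ∀ i, DependsOn (fun η => 1 - a i η)
      ((A.filter fun y => i :: x <:+ y : Finset (Vertex k)) : Set (Vertex k)) := by
    intro i η η' hη
    simp only [ha]
    congr 2
    refine propext (and_congr_right fun hi => ?_)
    rw [hη (i :: x) (by simpa using hi), reach_dependsOn A d (i :: x) fun v hv => hη v (by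
      simpa using ⟨(mem_below.1 hv).1, (mem_below.1 hv).2.1⟩)]
  rw [e1, blockMean_sub, blockMean_const, blockMean_prod Finset.univ hdep
    (fun i => (Finset.filter_subset _ _).trans hA) fun i j hij => disjoint_subtree A x hij]
  have hpθ : p * θ ≤ 1 := by nlinarith
  have : (1 - p * θ) ^ k ≤ ∏ i : Fin k, blockMean p A' (fun η => 1 - a i η) ω := by
    rw [← Fin.prod_const]
    refine Finset.prod_le_prod (fun i _ => by linarith) fun i _ => ?_
    rw [blockMean_sub, blockMean_const]
    linarith [hmean i]
  linarith

/-- The binary tree is the worst case of the critical recursion, which keeps the survival bound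
independent of `k`. This is Bernoulli's inequality with exponent `k / 2 ≥ 1`, squared. -/
theorem sq_le_one_sub_div_pow (hk : 2 ≤ k) {θ : ℝ} (hθ1 : θ ≤ 1) :
    (1 - θ / 2) ^ 2 ≤ (1 - θ / k) ^ k := by
  have hk' : (2 : ℝ) ≤ k := by exact_mod_cast hk
  have h1 : θ / k ≤ 1 := by rw [div_le_one (by linarith)]; linarith
  have h := one_add_mul_self_le_rpow_one_add (s := -(θ / k)) (by linarith) (p := k / 2)
    (by linarith)
  have e : 1 + (k : ℝ) / 2 * -(θ / k) = 1 - θ / 2 := by field_simp; ring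
  rw [e] at h
  refine (pow_le_pow_left₀ (by linarith) h 2).trans (le_of_eq ?_)
  rw [← Real.rpow_natCast (_ ^ _) 2, ← Real.rpow_mul (by linarith), ← Real.rpow_natCast _ k]
  push_cast
  rw [div_mul_cancel₀ _ (by norm_num), sub_eq_add_neg]

/-- The critical recursion is dominated by `θ ↦ θ - θ ^ 2 / 4`, for which `4 / (d + 4)` is a
supersolution. -/
theorem blockMean_reachInd_le_critical (hk : 2 ≤ k) (hp : (p : ℝ) * k ≤ 1)
    {A A' : Finset (Vertex k)} (hA : A ⊆ A') (d : ℕ) (x : Vertex k) (ω : Config k) :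
    blockMean p A' (reachInd A d x) ω ≤ 4 / (d + 4) := by
  induction d generalizing x ω with
  | zero =>
    have : reachInd A 0 x = fun _ => 1 := by funext η; simp [reachInd, Reach]
    simp [this, blockMean_const]
  | succ d ih =>
    have hp0 := p.2.1
    have hk' : (0 : ℝ) < k := by exact_mod_cast (by omega : 0 < k)
    have hθ0 : (0 : ℝ) ≤ 4 / (d + 4) := by positivity
    have hθ1 : (4 : ℝ) / (d + 4) ≤ 1 := by
      rw [div_le_one (by positivity)]; linarith [Nat.cast_nonneg (α := ℝ) d]
    refine (blockMean_reachInd_succ_le hA hθ0 hθ1 ih x ω).trans ?_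
    have h1 := sq_le_one_sub_div_pow hk hθ1
    have h2 : (p : ℝ) * (4 / (d + 4)) ≤ 4 / ((d : ℝ) + 4) / k := by
      rw [le_div_iff₀ hk']
      nlinarith
    have h3 : 4 / ((d : ℝ) + 4) / k ≤ 1 :=
      (div_le_one hk').2 (hθ1.trans (by exact_mod_cast (by omega : 1 ≤ k)))
    have h4 := pow_le_pow_left₀ (sub_nonneg.2 h3) (sub_le_sub_left h2 1) k
    -- This reduces to `(d + 3) * (d + 5) ≤ (d + 4) ^ 2`.
    have h5 : 1 - (1 - 4 / ((d : ℝ) + 4) / 2) ^ 2 ≤ 4 / ((d + 1 : ℕ) + 4) := by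
      push_cast
      rw [le_div_iff₀ (by positivity)]
      have hd : (0 : ℝ) < d + 4 := by positivity
      have e : 1 - (1 - 4 / ((d : ℝ) + 4) / 2) ^ 2 = 4 * (d + 3) / (d + 4) ^ 2 := by
        field_simp; ring
      rw [e, div_mul_eq_mul_div, div_le_iff₀ (by positivity)]
      nlinarith
    linarith

theorem blockMean_reachInd_le_pow (hp : (p : ℝ) * k ≤ 1)
    {A A' : Finset (Vertex k)} (hA : A ⊆ A') (d : ℕ) (x : Vertex k) (ω : Config k) :
    blockMean p A' (reachInd A d x) ω ≤ (p * k) ^ d := by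
  induction d generalizing x ω with
  | zero =>
    have : reachInd A 0 x = fun _ => 1 := by funext η; simp [reachInd, Reach]
    simp [this, blockMean_const]
  | succ d ih =>
    have hp0 := p.2.1
    have hp1 := p.2.2
    have hpk : (0 : ℝ) ≤ p * k := by positivity
    have hθ1 : ((p : ℝ) * k) ^ d ≤ 1 := pow_le_one₀ hpk hp
    refine (blockMean_reachInd_succ_le hA (by positivity) hθ1 ih x ω).trans ?_
    have := one_add_mul_le_pow (a := -(p * ((p : ℝ) * k) ^ d)) (by nlinarith [pow_nonneg hpk d]) k
    rw [← sub_eq_add_neg] at this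
    rw [pow_succ]
    linarith

/-! ### Polynomial bounds on finite regions -/

open scoped Classical in
/-- The indicator that all children of `y` in `A` are empty. -/
noncomputable def emptyBelow (A : Finset (Vertex k)) (y : Vertex k) (ω : Config k) : ℝ :=
  if ∀ i : Fin k, i :: y ∈ A → ω (i :: y) = false then 1 else 0

theorem emptyBelow_nonneg (A : Finset (Vertex k)) (y : Vertex k) (ω : Config k) :
    0 ≤ emptyBelow A y ω := by unfold emptyBelow; split_ifs <;> simp

/-- The Poincaré inequality with constant `T` in all finite regions that span at most `h`
consecutive levels, with empty boundary condition. -/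
def RegionPoincare (k : ℕ) (p : I) (h : ℕ) (T : ℝ) : Prop :=
  ∀ (A : Finset (Vertex k)) (a : ℕ), (∀ y ∈ A, a ≤ y.length ∧ y.length < a + h) →
    ∀ (f : Config k → ℝ) (ω : Config k), blockVar p A f ω ≤
      T * ∑ y ∈ A, blockMean p A (fun η => emptyBelow A y η * blockVar p {y} f η) ω

/-- On a single level no vertex has a child in the region, so nothing is constrained and the
inequality is the tensorization of the variance. -/
theorem regionPoincare_one : RegionPoincare k p 1 1 := by
  intro A a hA f ω
  rw [one_mul, blockVar_eq_sum]
  refine Finset.sum_le_sum fun y hy => ?_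
  have e : (fun η => emptyBelow A y η * blockVar p {y} f η) = blockVar p {y} f := by
    funext η
    rw [emptyBelow, if_pos, one_mul]
    intro i hi
    have h1 := hA y hy
    have h2 := hA _ hi
    simp at h2
    omega
  rw [e, ← blockMean_of_subset (after_subset A y) (blockVar p {y} f)]
  exact blockMean_mono (fun ω' => blockVar_blockMean_le _ _ _ ω') A ω

/-- The region supplies its own empty boundary: a child in `A` of a vertex of the region that is not
in the region either lies on level `M` or reaches it, so if it were occupied its parent would reach
level `M` too. -/
theorem emptyBelow_explored_le {A : Finset (Vertex k)} {M : ℕ} {ω : Config k} {y : Vertex k}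
    (hy : y ∈ explored A M ω) : emptyBelow (explored A M ω) y ω ≤ emptyBelow A y ω := by
  by_cases h : ∀ i : Fin k, i :: y ∈ explored A M ω → ω (i :: y) = false
  · rw [emptyBelow, emptyBelow, if_pos h, if_pos]
    intro i hi
    by_contra hne
    rw [Bool.not_eq_false] at hne
    obtain ⟨-, hlt, hn⟩ := mem_explored.1 hy
    obtain ⟨d, hd⟩ : ∃ d, M - y.length = d + 1 := ⟨M - y.length - 1, by omega⟩
    rw [hd] at hn
    have hr : ¬ Reach A d (i :: y) ω := fun hr => hn ⟨i, hi, hne, hr⟩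
    rcases Nat.eq_zero_or_pos d with rfl | hd0
    · exact hr trivial
    · have : i :: y ∈ explored A M ω := mem_explored.2 ⟨hi, by simp; omega, by
        rwa [show M - (i :: y).length = d by simp; omega]⟩
      rw [h i this] at hne
      exact absurd hne (by simp)
  · rw [emptyBelow, if_neg h]
    exact emptyBelow_nonneg _ _ _

theorem RegionPoincare.explored {h : ℕ} {T : ℝ} (hP : RegionPoincare k p h T) (hT : 0 ≤ T)
    {A A' : Finset (Vertex k)} (hA : A ⊆ A') {a M : ℕ}
    (hlev : ∀ y ∈ A, y.length < M → a ≤ y.length ∧ y.length < a + h) (f : Config k → ℝ)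
    (ω : Config k) :
    blockMean p A' (fun ω' => blockVar p (explored A M ω') f ω') ω ≤
      T * ∑ y ∈ A with y.length < M,
        blockMean p A' (fun η => emptyBelow A y η * blockVar p {y} f η) ω := by
  have hR := explored_isExplored A M
  have key : ∀ ω', blockVar p (OFA.explored A M ω') f ω' ≤
      T * ∑ y ∈ A with y.length < M, blockMean p (OFA.explored A M ω')
        (fun η => emptyBelow A y η * blockVar p {y} f η) ω' := fun ω' => by
    refine (hP _ a (fun y hy => hlev y (mem_explored.1 hy).1 (mem_explored.1 hy).2.1) f ω').trans
      (mul_le_mul_of_nonneg_left ?_ hT)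
    refine (Finset.sum_le_sum fun y hy => ?_).trans (Finset.sum_le_sum_of_subset_of_nonneg
      (fun y hy => Finset.mem_filter.2 ⟨(mem_explored.1 hy).1, (mem_explored.1 hy).2.1⟩)
      fun y _ _ => blockMean_nonneg (fun η => mul_nonneg (emptyBelow_nonneg _ _ _)
        (blockVar_nonneg _ _ _)) ω')
    -- On the fibre the region is constant, so it may be recomputed from `η`; region and
    -- configuration then match as `emptyBelow_explored_le` requires.
    have e : blockMean p (OFA.explored A M ω')
        (fun η => emptyBelow (OFA.explored A M ω') y η * blockVar p {y} f η) ω' =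
        blockMean p (OFA.explored A M ω') (fun η => (if y ∈ OFA.explored A M η then
          emptyBelow (OFA.explored A M η) y η else 0) * blockVar p {y} f η) ω' :=
      blockMean_congr fun η hη => by simp only [hR _ _ hη, hy, if_true]
    rw [e]
    refine blockMean_mono (fun η => mul_le_mul_of_nonneg_right ?_ (blockVar_nonneg _ _ _)) _ ω'
    split_ifs with h
    · exact emptyBelow_explored_le h
    · exact emptyBelow_nonneg _ _ _
  refine (blockMean_mono key A' ω).trans (le_of_eq ?_)
  rw [blockMean_const_mul, blockMean_sum]
  congr 1
  exact Finset.sum_congr rfl fun y _ =>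
    blockMean_explored hR (fun ω' => (explored_subset A M ω').trans hA) _ ω

/-- The ancestors of `y` form a chain with one vertex per level, so they are counted by their
lengths. -/
theorem card_suffix_le (S : Finset (Vertex k)) (y : Vertex k) (a b : ℕ)
    {P : Vertex k → Prop} [DecidablePred P]
    (hP : ∀ x ∈ S, P x → x <:+ y ∧ a ≤ x.length ∧ x.length < b) : (S.filter P).card ≤ b - a := by
  rw [← Nat.card_Ico]
  refine Finset.card_le_card_of_injOn List.length (fun x hx => ?_) fun x hx x' hx' h => ?_
  · obtain ⟨hx, hx'⟩ := Finset.mem_filter.1 hx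
    simpa using (hP x hx hx').2
  · obtain ⟨h1, h2⟩ := Finset.mem_filter.1 hx
    obtain ⟨h3, h4⟩ := Finset.mem_filter.1 hx'
    exact (List.suffix_of_suffix_length_le (hP x h1 h2).1 (hP x' h3 h4).1 h.le).eq_of_length h

theorem suffix_of_mem_insert_below {A : Finset (Vertex k)} {x y : Vertex k}
    (h : y ∈ insert x (below A x)) : x <:+ y := by
  rcases Finset.mem_insert.1 h with rfl | h
  · exact List.suffix_refl _
  · exact (mem_below.1 h).2.1

theorem one_sub_exploredInd {A : Finset (Vertex k)} {M : ℕ} {x : Vertex k} (hx : x ∈ A)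
    (hM : x.length < M) (ω : Config k) :
    1 - (if x ∈ explored A M ω then (1 : ℝ) else 0) = reachInd A (M - x.length) x ω := by
  unfold reachInd
  by_cases h : Reach A (M - x.length) x ω <;> simp [mem_explored, hx, hM, h]

theorem exploredInd_dependsOn {A : Finset (Vertex k)} {M : ℕ} {x : Vertex k} :
    DependsOn (fun ω => if x ∈ explored A M ω then (1 : ℝ) else 0)
      (below A x : Set (Vertex k)) := fun ω ω' h => by
  have h' : Reach A (M - x.length) x ω = Reach A (M - x.length) x ω' := reach_dependsOn A _ x h
  exact if_congr (by rw [mem_explored, mem_explored, h']) rfl rfl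

/-- Two overlapping blocks of `n - s` levels cover the `n` levels: the lower one is `A \ S`, and the
upper one contains the explored region. A path that spoils the constraint at a vertex of the top `s`
levels has length at least `n - 2 * s + 1`. The factor is `361 = 181 + 180`. -/
theorem RegionPoincare.step (hk : 2 ≤ k) (hp : (p : ℝ) * k ≤ 1) {n s : ℕ} (hn : 2 ≤ n)
    (hs : 7 * s ≤ n + 5) {T : ℝ} (hT : 0 ≤ T) (hP : RegionPoincare k p (n - s) T) :
    RegionPoincare k p n (361 * T) := by
  intro A a hA f ω
  set S := A.filter fun y => y.length < a + s with hS
  set M := a + (n - s) with hM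
  have hSA : S ⊆ A := Finset.filter_subset _ _
  have hSM : ∀ x ∈ S, x.length < M := fun x hx => by
    have := (Finset.mem_filter.1 hx).2
    omega
  have hsn : 2 * s ≤ n := by omega
  have hden : (0 : ℝ) < n - 2 * s + 5 := by
    have : (2 * s : ℝ) ≤ n := by exact_mod_cast hsn
    linarith
  have h1 := blockVar_two_block (p := p) hSA (explored_isExplored A M) (explored_subset A M)
    (explored_isOriented subset_rfl M) (U := below A)
    (fun x _ => below_subset_after subset_rfl x)
    (c := fun x ω => if x ∈ OFA.explored A M ω then 1 else 0) (fun _ _ => rfl)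
    (fun x _ => exploredInd_dependsOn) (η := 4 / (n - 2 * s + 5)) (by positivity)
    (fun x hx ω => ?_) (N := s) (fun y hy => ?_) ?_ f ω
  · have h2 := hP.explored hT subset_rfl (A := A) (a := a) (M := M)
      (fun y hy hyM => ⟨(hA y hy).1, hyM⟩) f ω
    have h3 := blockMean_mono (p := p) (fun ω' => hP (A \ S) (a + s) (fun y hy => by
      obtain ⟨hy1, hy2⟩ := Finset.mem_sdiff.1 hy
      have := hA y hy1
      have h4 : ¬ y.length < a + s := fun h => hy2 (Finset.mem_filter.2 ⟨hy1, h⟩)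
      omega) f ω') A ω
    rw [blockMean_const_mul, blockMean_sum] at h3
    set E : Vertex k → ℝ := fun y =>
      blockMean p A (fun η => emptyBelow A y η * blockVar p {y} f η) ω with hE
    have hE0 : ∀ y, 0 ≤ E y := fun y => blockMean_nonneg (fun η =>
      mul_nonneg (emptyBelow_nonneg _ _ _) (blockVar_nonneg _ _ _)) ω
    have h5 : ∑ y ∈ A with y.length < M, E y ≤ ∑ y ∈ A, E y :=
      Finset.sum_le_sum_of_subset_of_nonneg (Finset.filter_subset _ _) fun y _ _ => hE0 y
    have h6 : ∑ y ∈ A \ S, blockMean p A (blockMean p (A \ S) fun η =>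
        emptyBelow (A \ S) y η * blockVar p {y} f η) ω ≤ ∑ y ∈ A, E y := by
      refine le_trans (le_of_eq ?_) (Finset.sum_le_sum_of_subset_of_nonneg
        (Finset.sdiff_subset (s := A) (t := S)) fun y _ _ => hE0 y)
      refine Finset.sum_congr rfl fun y hy => ?_
      rw [blockMean_of_subset Finset.sdiff_subset]
      refine blockMean_congr fun η _ => ?_
      -- Removing top levels removes no child of a remaining vertex, so the constraints in `A \ S`
      -- are those of `A`.
      have : ∀ i : Fin k, i :: y ∈ A \ S ↔ i :: y ∈ A := fun i => by
        obtain ⟨hy1, hy2⟩ := Finset.mem_sdiff.1 hy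
        refine ⟨fun h => (Finset.mem_sdiff.1 h).1, fun h => Finset.mem_sdiff.2 ⟨h, fun h' => hy2 ?_⟩⟩
        have := (Finset.mem_filter.1 h').2
        exact Finset.mem_filter.2 ⟨hy1, by simp at this; omega⟩
      simp only [emptyBelow, this]
    have h7 := mul_le_mul_of_nonneg_left h5 hT
    have h8 := mul_le_mul_of_nonneg_left h6 hT
    simp only [hE] at *
    linarith
  · simp only [one_sub_exploredInd (hSA hx) (hSM x hx)]
    refine (blockMean_reachInd_le_critical hk hp subset_rfl _ x ω).trans ?_
    have h2 : x.length < a + s := (Finset.mem_filter.1 hx).2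
    have h3 : n + 1 ≤ (M - x.length) + 2 * s := by omega
    have h4 : (n : ℝ) + 1 ≤ ((M - x.length : ℕ) : ℝ) + 2 * s := by exact_mod_cast h3
    exact div_le_div_of_nonneg_left (by norm_num) hden (by linarith)
  · refine (card_suffix_le S y a (a + s) fun x hx hxy => ⟨suffix_of_mem_insert_below hxy,
      (hA x (hSA hx)).1, (Finset.mem_filter.1 hx).2⟩).trans (by omega)
  -- With `η = 4 / (n - 2 * s + 5)` and `N = s`, the condition `η * N ≤ 4 / 5` is exactly `7 * s ≤ n
  -- + 5`.
  · rw [div_mul_eq_mul_div, div_le_div_iff₀ hden (by norm_num)]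
    have : (7 * s : ℝ) ≤ n + 5 := by exact_mod_cast hs
    linarith

theorem regionPoincare_pow (hk : 2 ≤ k) (hp : (p : ℝ) * k ≤ 1) (n : ℕ) (hn : 1 ≤ n) :
    RegionPoincare k p n ((n : ℝ) ^ 80) := by
  induction n using Nat.strong_induction_on with
  | _ n ih =>
    rcases hn.eq_or_lt with rfl | hn2
    · simpa using regionPoincare_one
    · have hs := Nat.div_add_mod (n + 5) 7
      have hs' := Nat.mod_lt (n + 5) (by norm_num : 0 < 7)
      -- The largest admissible overlap parameter; it makes `n - s` at most `13 / 14 * n` for every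
      -- `n ≥ 2`.
      set s := (n + 5) / 7 with hsdef
      have h1 := (ih (n - s) (by omega) (by omega)).step hk hp hn2 (s := s) (by omega)
        (by positivity)
      have h2 : 14 * (n - s) ≤ 13 * n := by omega
      have h3 : ((n - s : ℕ) : ℝ) ≤ 13 / 14 * n := by
        have : (14 * (n - s : ℕ) : ℝ) ≤ 13 * n := by exact_mod_cast h2
        linarith
      have h4 : 361 * ((n - s : ℕ) : ℝ) ^ 80 ≤ (n : ℝ) ^ 80 := by
        have h5 := pow_le_pow_left₀ (Nat.cast_nonneg _) h3 80
        rw [mul_pow] at h5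
        -- The exponent `80` is chosen so that one step of the recursion, a loss of `361` against a
        -- gain of `13 / 14` in scale, closes.
        have h6 : (361 : ℝ) * (13 / 14) ^ 80 ≤ 1 := by norm_num
        nlinarith [pow_nonneg (Nat.cast_nonneg (α := ℝ) n) 80]
      intro A a hA f ω
      refine (h1 A a hA f ω).trans (mul_le_mul_of_nonneg_right h4 ?_)
      exact Finset.sum_nonneg fun y _ => blockMean_nonneg (fun η =>
        mul_nonneg (emptyBelow_nonneg _ _ _) (blockVar_nonneg _ _ _)) ω

/-! ### The Poincaré inequality for local functions below criticality -/

theorem constraint_nonneg (x : Vertex k) (ω : Config k) : 0 ≤ constraint x ω := by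
  unfold constraint; split_ifs <;> simp

theorem emptyBelow_eq_constraint {A : Finset (Vertex k)} {y : Vertex k}
    (h : ∀ i : Fin k, i :: y ∈ A) : emptyBelow A y = constraint y := by
  funext ω
  simp [emptyBelow, constraint, h]

/-- One explored region of depth `l` is attached to each vertex `x` instead of a bisection of the
whole tree, so the constant depends on `l` and not on the support of `f`. The region has at most `l`
levels and costs `l ^ 80`; each vertex lies below at most `l` such roots, which gives the last
factor `l`. -/
theorem blockVar_le_of_local (hk : 2 ≤ k) (hp : (p : ℝ) * k ≤ 1) {l : ℕ} (hl : 1 ≤ l)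
    (hpl : ((p : ℝ) * k) ^ l * (l + 1) ≤ 4 / 5) {f : Config k → ℝ} {S : Finset (Vertex k)}
    (hf : DependsOn f (S : Set (Vertex k))) :
    ∃ A : Finset (Vertex k), S ⊆ A ∧ (∀ y ∈ S, ∀ i : Fin k, i :: y ∈ A) ∧ ∀ ω,
      blockVar p A f ω ≤ 90 * (l : ℝ) ^ 81 *
        ∑ y ∈ S, blockMean p A (fun η => constraint y η * blockVar p {y} f η) ω := by
  classical
  obtain ⟨n, hn⟩ : ∃ n : ℕ, ∀ y ∈ S, y.length < n :=
    ⟨S.sup List.length + 1, fun y hy => Nat.lt_succ_of_le (Finset.le_sup (f := List.length) hy)⟩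
  -- The `l` extra levels let every local subtree of depth `l` rooted above level `n` fit in `A`, so
  -- that the boundary constraint there is the true `constraint`.
  set A : Finset (Vertex k) := (List.finite_length_le (Fin k) (n + l)).toFinset with hA
  have hmem : ∀ y : Vertex k, y ∈ A ↔ y.length ≤ n + l := fun y => by simp [hA]
  refine ⟨A, fun y hy => (hmem y).2 (by have := hn y hy; omega), fun y hy i =>
    (hmem _).2 (by have := hn y hy; simp; omega), fun ω => ?_⟩
  set S' := A.filter fun y => y.length < n with hS'
  have hS'A : S' ⊆ A := Finset.filter_subset _ _
  have hS'n : ∀ x ∈ S', x.length < n := fun x hx => (Finset.mem_filter.1 hx).2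
  set B : Vertex k → Finset (Vertex k) := fun x =>
    A.filter fun y => x <:+ y ∧ y.length ≤ x.length + l with hB
  have hBA : ∀ x, B x ⊆ A := fun x => Finset.filter_subset _ _
  have hxB : ∀ x ∈ S', x ∈ B x := fun x hx => Finset.mem_filter.2 ⟨hS'A hx, List.suffix_refl _,
    by omega⟩
  set R : Vertex k → Config k → Finset (Vertex k) := fun x => explored (B x) (x.length + l) with hR
  have hRA : ∀ x ω, R x ω ⊆ A := fun x ω => (explored_subset _ _ _).trans (hBA x)
  have h1 := blockVar_le_sum_constraint (p := p) hS'A (g := f) (fun ω ω' h => ?_)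
    (U := fun x => below (B x) x) (fun x _ => below_subset_after (hBA x) x)
    (c := fun x ω => if x ∈ R x ω then 1 else 0) (fun x ω => by split_ifs <;> simp)
    (fun x _ => exploredInd_dependsOn) (η := ((p : ℝ) * k) ^ l)
    (pow_nonneg (mul_nonneg p.2.1 (Nat.cast_nonneg k)) l) (fun x hx ω => ?_) (N := l + 1)
    (fun y hy => ?_) (by push_cast; exact hpl) ω
  rotate_left
  · refine hf fun v hv => h v fun hvA => ?_
    obtain ⟨h2, h3⟩ := Finset.mem_sdiff.1 hvA
    exact h3 (Finset.mem_filter.2 ⟨h2, hn v hv⟩)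
  · simp only [hR, one_sub_exploredInd (hxB x hx) (by omega : x.length < x.length + l)]
    rw [Nat.add_sub_cancel_left]
    exact blockMean_reachInd_le_pow hp (hBA x) l x ω
  -- A vertex is charged only by itself and its ancestors at distance at most `l`.
  · refine (card_suffix_le S' y (y.length - l) (y.length + 1) fun x _ hxy => ?_).trans (by omega)
    refine ⟨suffix_of_mem_insert_below hxy, ?_, ?_⟩
    · rcases Finset.mem_insert.1 hxy with rfl | h
      · omega
      · have := (Finset.mem_filter.1 (mem_below.1 h).1).2.2
        omega
    · have := (suffix_of_mem_insert_below hxy).length_le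
      omega
  set E : Vertex k → ℝ := fun y =>
    blockMean p A (fun η => constraint y η * blockVar p {y} f η) ω with hE
  have hE0 : ∀ y, 0 ≤ E y := fun y => blockMean_nonneg (fun η =>
    mul_nonneg (constraint_nonneg _ _) (blockVar_nonneg _ _ _)) ω
  have h2 : ∀ x ∈ S', blockMean p A (blockVar p {x} (blockMean p (after A x) fun ω' =>
      (if x ∈ R x ω' then 1 else 0) * f ω')) ω ≤
      (l : ℝ) ^ 80 * ∑ y ∈ A with x <:+ y ∧ y.length < x.length + l, E y := by
    intro x hx
    have h3 := sum_blockVar_indicator_le (p := p) (S := {x}) (by simpa using hS'A hx)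
      (explored_isExplored (B x) (x.length + l)) (hRA x) (explored_isOriented (hBA x) _) f ω
    rw [Finset.sum_singleton] at h3
    have h4 := (regionPoincare_pow hk hp l hl).explored (by positivity) (hBA x) (a := x.length)
      (M := x.length + l) (fun y hy hyM => ⟨(Finset.mem_filter.1 hy).2.1.length_le, hyM⟩) f ω
    refine h3.trans (h4.trans (le_of_eq ?_))
    congr 1
    have e : (B x).filter (fun y => y.length < x.length + l) =
        A.filter fun y => x <:+ y ∧ y.length < x.length + l := by
      ext y
      simp only [hB, Finset.mem_filter]
      constructor
      · rintro ⟨⟨h5, h6, _⟩, h7⟩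
        exact ⟨h5, h6, h7⟩
      · rintro ⟨h5, h6, h7⟩
        exact ⟨⟨h5, h6, h7.le⟩, h7⟩
    rw [e]
    refine Finset.sum_congr rfl fun y hy => ?_
    obtain ⟨_, h6, h7⟩ := Finset.mem_filter.1 hy
    rw [emptyBelow_eq_constraint]
    intro i
    refine Finset.mem_filter.2 ⟨(hmem _).2 ?_, h6.trans (List.suffix_cons i y), ?_⟩
    · have := hS'n x hx
      simp; omega
    · simp; omega
  have h5 := Finset.sum_le_sum h2
  rw [← Finset.mul_sum] at h5
  have h6 : ∑ x ∈ S', ∑ y ∈ A with x <:+ y ∧ y.length < x.length + l, E y ≤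
      l * ∑ y ∈ A, E y := by
    simp only [Finset.sum_filter]
    rw [Finset.sum_comm, Finset.mul_sum]
    refine Finset.sum_le_sum fun y _ => ?_
    rw [← Finset.sum_filter, Finset.sum_const, nsmul_eq_mul]
    refine mul_le_mul_of_nonneg_right ?_ (hE0 y)
    -- The lower end is a truncated subtraction, which can only shorten the interval: it has at most
    -- `l` levels.
    have := card_suffix_le S' y (y.length + 1 - l) (y.length + 1)
      (P := fun x => x <:+ y ∧ y.length < x.length + l) fun x _ hxy =>
        ⟨hxy.1, by omega, by have := hxy.1.length_le; omega⟩
    exact_mod_cast this.trans (by omega)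
  have h7 : ∑ y ∈ A, E y = ∑ y ∈ S, E y := by
    symm
    refine Finset.sum_subset (fun y hy => (hmem y).2 (by have := hn y hy; omega)) fun y _ hy => ?_
    have : (fun η => constraint y η * blockVar p {y} f η) = fun _ => 0 := funext fun η => by
      rw [blockVar_eq_zero fun ω' hω' => agreeOff_of_dependsOn hf (by simpa using hy) hω', mul_zero]
    simp only [hE, this, blockMean_const]
  rw [h7] at h6
  have h8 : (l : ℝ) ^ 81 = l ^ 80 * l := pow_succ _ _
  have h9 := mul_le_mul_of_nonneg_left h6 (by positivity : (0 : ℝ) ≤ l ^ 80)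
  rw [h8]
  simp only [hE] at *
  linarith

/-- With `u = (1 - ε / 2) ^ l` one has `(1 - ε) ^ l ≤ u ^ 2` and, by Bernoulli, `u ≤ 1 / (1 + l * ε
/ 2)`. The square of the denominator dominates `l ^ 2 * ε ^ 2 / 4 ≥ 2 * l`, which beats `5 / 4 * (l
+ 1)`. -/
theorem one_sub_pow_mul_le {ε : ℝ} (h0 : 0 < ε) (h1 : ε ≤ 1) {l : ℕ} (hl : 8 / ε ^ 2 ≤ l) :
    (1 - ε) ^ l * (l + 1) ≤ 4 / 5 := by
  have hl8 : (8 : ℝ) ≤ l * ε ^ 2 := (div_le_iff₀ (by positivity)).1 hl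
  have hl1 : (8 : ℝ) ≤ l := by nlinarith [Nat.cast_nonneg (α := ℝ) l, pow_le_one₀ h0.le h1 (n := 2)]
  have hb := one_add_mul_le_pow (a := ε / 2) (by linarith) l
  have ha : (1 - ε) ^ l ≤ ((1 - ε / 2) ^ l) ^ 2 := by
    rw [← pow_mul, mul_comm l 2, pow_mul]
    exact pow_le_pow_left₀ (by linarith) (by nlinarith) l
  have hc : (1 - ε / 2) ^ l * (1 + ε / 2) ^ l ≤ 1 := by
    rw [← mul_pow]
    exact pow_le_one₀ (by nlinarith) (by nlinarith)
  set u := (1 - ε / 2) ^ l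
  have hu : 0 ≤ u := pow_nonneg (by linarith) l
  have hd : u * (1 + l * (ε / 2)) ≤ 1 := (mul_le_mul_of_nonneg_left hb hu).trans hc
  have he : (5 / 4) * ((l : ℝ) + 1) ≤ (1 + l * (ε / 2)) ^ 2 := by nlinarith
  have hg : (u * (1 + l * (ε / 2))) ^ 2 ≤ 1 := pow_le_one₀ (by positivity) hd
  rw [mul_pow] at hg
  have h2 := mul_le_mul_of_nonneg_left he (sq_nonneg u)
  have h3 := mul_le_mul_of_nonneg_right ha (by positivity : (0 : ℝ) ≤ l + 1)
  linarith

/-! ### Local functions and the measure `μ` -/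

theorem IsLocal.exists_comp {f : Config k → ℝ} (hf : IsLocal f) :
    ∃ (S : Finset (Vertex k)) (g : (S → Bool) → ℝ), f = g ∘ S.restrict := by
  obtain ⟨S, hS⟩ := hf
  refine ⟨S, fun η => f fun v => if h : v ∈ S then η ⟨v, h⟩ else false, funext fun ω => ?_⟩
  refine hS fun v hv => ?_
  have hv' : v ∈ S := hv
  simp [hv']

theorem IsLocal.measurable {f : Config k → ℝ} (hf : IsLocal f) : Measurable f := by
  obtain ⟨S, g, rfl⟩ := hf.exists_comp
  exact (measurable_of_countable g).comp (Finset.measurable_restrict S)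

theorem IsLocal.bounded {f : Config k → ℝ} (hf : IsLocal f) : ∃ C, ∀ ω, ‖f ω‖ ≤ C := by
  obtain ⟨S, g, rfl⟩ := hf.exists_comp
  obtain ⟨C, hC⟩ := (Set.finite_range fun η => ‖g η‖).bddAbove
  exact ⟨C, fun ω => hC ⟨S.restrict ω, rfl⟩⟩

theorem IsLocal.memLp {f : Config k → ℝ} (hf : IsLocal f) (p : I) : MemLp f 2 (μ k p) := by
  obtain ⟨C, hC⟩ := hf.bounded
  exact MemLp.of_bound hf.measurable.aestronglyMeasurable C (Filter.Eventually.of_forall hC)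

theorem IsLocal.integrable {f : Config k → ℝ} (hf : IsLocal f) (p : I) : Integrable f (μ k p) :=
  (hf.memLp p).integrable (by norm_num)

theorem isLocal_const (a : ℝ) : IsLocal fun _ : Config k => a := ⟨∅, fun _ _ _ => rfl⟩

theorem IsLocal.comp₂ {f g : Config k → ℝ} (hf : IsLocal f) (hg : IsLocal g) (F : ℝ → ℝ → ℝ) :
    IsLocal fun ω => F (f ω) (g ω) := by
  obtain ⟨S, hS⟩ := hf
  obtain ⟨T, hT⟩ := hg
  refine ⟨S ∪ T, fun ω η h => ?_⟩
  have h1 := hS fun i hi => h i (by simp only [Finset.coe_union]; exact Or.inl hi)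
  have h2 := hT fun i hi => h i (by simp only [Finset.coe_union]; exact Or.inr hi)
  simp only [h1, h2]

theorem IsLocal.mul {f g : Config k → ℝ} (hf : IsLocal f) (hg : IsLocal g) :
    IsLocal fun ω => f ω * g ω := hf.comp₂ hg (· * ·)

theorem IsLocal.sub {f g : Config k → ℝ} (hf : IsLocal f) (hg : IsLocal g) :
    IsLocal fun ω => f ω - g ω := hf.comp₂ hg (· - ·)

theorem IsLocal.sq {f : Config k → ℝ} (hf : IsLocal f) : IsLocal fun ω => f ω ^ 2 :=
  hf.comp₂ hf fun a _ => a ^ 2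

theorem IsLocal.sum {ι : Type*} {s : Finset ι} {f : ι → Config k → ℝ}
    (hf : ∀ i ∈ s, IsLocal (f i)) : IsLocal fun ω => ∑ i ∈ s, f i ω := by
  classical
  induction s using Finset.induction_on with
  | empty => simpa using isLocal_const 0
  | insert a s ha ih =>
    simp only [Finset.sum_insert ha]
    exact (hf a (by simp)).comp₂ (ih fun i hi => hf i (by simp [hi])) (· + ·)

theorem IsLocal.blockMean {f : Config k → ℝ} (hf : IsLocal f) (p : I) (A : Finset (Vertex k)) :
    IsLocal (blockMean p A f) := by
  obtain ⟨S, hS⟩ := hf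
  exact ⟨S, (blockMean_dependsOn hS A).mono Set.sdiff_subset⟩

theorem IsLocal.siteMean {f : Config k → ℝ} (hf : IsLocal f) (p : I) (x : Vertex k) :
    IsLocal (siteMean p x f) := by
  rw [← blockMean_singleton]
  exact hf.blockMean p {x}

theorem IsLocal.blockVar {f : Config k → ℝ} (hf : IsLocal f) (p : I) (A : Finset (Vertex k)) :
    IsLocal (blockVar p A f) := (hf.sq.blockMean p A).sub (hf.blockMean p A).sq

theorem constraint_dependsOn (x : Vertex k) : DependsOn (constraint x)
    ((Finset.univ.image fun i : Fin k => i :: x : Finset (Vertex k)) : Set (Vertex k)) :=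
  fun ω η h => by
    have : ∀ i : Fin k, ω (i :: x) = η (i :: x) := fun i => h _ (by simp)
    simp [constraint, this]

theorem isLocal_constraint (x : Vertex k) : IsLocal (constraint x) := ⟨_, constraint_dependsOn x⟩

/-! ### Integration against `μ` by resampling coordinates. -/

/-- Resampling one coordinate preserves the product measure; it suffices to compare cylinders,
according to whether they constrain `x`. -/
theorem measurePreserving_update (p : I) (x : Vertex k) :
    MeasurePreserving (fun z : Bool × Config k => Function.update z.2 x z.1)
      ((siteMeasure p).prod (μ k p)) (μ k p) := by
  have hm : Measurable fun z : Bool × Config k => Function.update z.2 x z.1 := by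
    refine measurable_pi_lambda _ fun v => ?_
    rcases eq_or_ne v x with rfl | h
    · simpa using measurable_fst
    · simp only [Function.update_of_ne h]
      exact (measurable_pi_apply v).comp measurable_snd
  refine ⟨hm, Measure.eq_infinitePi _ fun s t ht => ?_⟩
  rw [Measure.map_apply hm (MeasurableSet.pi s.countable_toSet fun i _ => ht i)]
  by_cases hx : x ∈ s
  · have e : (fun z : Bool × Config k => Function.update z.2 x z.1) ⁻¹' (s : Set (Vertex k)).pi t =
        t x ×ˢ ((s.erase x : Finset (Vertex k)) : Set (Vertex k)).pi t := by
      ext ⟨b, ω⟩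
      simp only [Set.mem_preimage, Set.mem_pi, Set.mem_prod, Finset.mem_coe, Finset.mem_erase]
      constructor
      · intro h
        exact ⟨by simpa using h x hx, fun i hi => by
          simpa [Function.update_of_ne hi.1] using h i hi.2⟩
      · rintro ⟨h1, h2⟩ i hi
        rcases eq_or_ne i x with rfl | hix
        · simpa using h1
        · simpa [Function.update_of_ne hix] using h2 i ⟨hix, hi⟩
    rw [e, Measure.prod_prod, Measure.infinitePi_pi _ fun i _ => ht i, Finset.mul_prod_erase s
      (fun i => siteMeasure p (t i)) hx]
  · have e : (fun z : Bool × Config k => Function.update z.2 x z.1) ⁻¹' (s : Set (Vertex k)).pi t =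
        Set.univ ×ˢ (s : Set (Vertex k)).pi t := by
      ext ⟨b, ω⟩
      simp only [Set.mem_preimage, Set.mem_pi, Set.mem_prod, Finset.mem_coe, Set.mem_univ, true_and]
      refine forall₂_congr fun i hi => ?_
      rw [Function.update_of_ne (ne_of_mem_of_not_mem hi hx)]
    rw [e, Measure.prod_prod, Measure.infinitePi_pi _ fun i _ => ht i, measure_univ, one_mul]

theorem integral_siteMean {f : Config k → ℝ} (hf : IsLocal f) (p : I) (x : Vertex k) :
    ∫ ω, siteMean p x f ω ∂(μ k p) = ∫ ω, f ω ∂(μ k p) := by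
  have hmp := measurePreserving_update p x
  have h1 : ∫ ω, f ω ∂(μ k p) =
      ∫ z, f (Function.update z.2 x z.1) ∂((siteMeasure p).prod (μ k p)) := by
    rw [← hmp.map_eq, integral_map hmp.measurable.aemeasurable
      (by rw [hmp.map_eq]; exact hf.measurable.aestronglyMeasurable)]
    rw [hmp.map_eq]
  rw [h1, integral_prod_symm]
  · rfl
  · obtain ⟨C, hC⟩ := hf.bounded
    exact Integrable.of_bound (hf.measurable.comp hmp.measurable).aestronglyMeasurable C
      (Filter.Eventually.of_forall fun z => hC _)

theorem integral_blockMean {f : Config k → ℝ} (hf : IsLocal f) (p : I) (A : Finset (Vertex k)) :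
    ∫ ω, blockMean p A f ω ∂(μ k p) = ∫ ω, f ω ∂(μ k p) := by
  induction A using Finset.induction_on with
  | empty => simp
  | insert x A _ ih => rw [blockMean_insert, integral_siteMean (hf.blockMean p A), ih]

theorem integral_eq_blockMean {f : Config k → ℝ} {A : Finset (Vertex k)}
    (hf : DependsOn f (A : Set (Vertex k))) (ω : Config k) :
    ∫ η, f η ∂(μ k p) = blockMean p A f ω := by
  rw [← integral_blockMean ⟨A, hf⟩ p A]
  simp [fun η => blockMean_eq_of_dependsOn (p := p) hf subset_rfl η ω]

/-! ### The Dirichlet form of local functions. -/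

theorem localGenerator_eq_sum {f : Config k → ℝ} {S : Finset (Vertex k)}
    (hf : DependsOn f (S : Set (Vertex k))) (p : I) (ω : Config k) :
    localGenerator p f ω = ∑ x ∈ S, constraint x ω * (siteMean p x f ω - f ω) := by
  refine finsum_eq_sum_of_support_subset _ fun x hx => ?_
  by_contra hxS
  refine hx ?_
  have hxS' : x ∉ S := hxS
  have : blockMean p {x} f ω = f ω :=
    blockMean_eq_self fun ω' hω' => agreeOff_of_dependsOn hf (by simpa using hxS') hω'
  rw [blockMean_singleton] at this
  simp [this]

theorem isLocal_localGenerator {f : Config k → ℝ} (hf : IsLocal f) (p : I) :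
    IsLocal (localGenerator p f) := by
  obtain ⟨S, hS⟩ := id hf
  rw [funext (localGenerator_eq_sum hS p)]
  exact IsLocal.sum fun x _ => (isLocal_constraint x).mul ((hf.siteMean p x).sub hf)

/-- The constraint at `x` does not look at `x`, so averaging first over that variable turns the
integrand into minus a conditional variance. -/
theorem integral_constraint_mul {f : Config k → ℝ} (hf : IsLocal f) (p : I) (x : Vertex k) :
    ∫ ω, f ω * (constraint x ω * (siteMean p x f ω - f ω)) ∂(μ k p) =
      -∫ ω, constraint x ω * blockVar p {x} f ω ∂(μ k p) := by
  have hl : IsLocal fun ω => f ω * (constraint x ω * (siteMean p x f ω - f ω)) :=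
    hf.mul ((isLocal_constraint x).mul ((hf.siteMean p x).sub hf))
  rw [← integral_blockMean hl p {x}, ← integral_neg]
  congr 1
  funext ω
  have hc : ∀ ω', AgreeOff {x} ω ω' → constraint x ω' = constraint x ω := fun ω' hω' =>
    agreeOff_of_dependsOn (constraint_dependsOn x) (by simp) hω'
  have e : (fun ω => f ω * (constraint x ω * (siteMean p x f ω - f ω))) = fun ω =>
      constraint x ω * (blockMean p {x} f ω * f ω - f ω ^ 2) := by
    rw [blockMean_singleton]; ext; ring
  rw [e, blockMean_mul_left hc, blockMean_sub,
    blockMean_mul_left fun ω' hω' => blockMean_fibre _ _ hω', blockVar]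
  ring

theorem integral_mul_localGenerator {f : Config k → ℝ} {S : Finset (Vertex k)}
    (hS : DependsOn f (S : Set (Vertex k))) (p : I) :
    ∫ ω, f ω * -localGenerator p f ω ∂(μ k p) =
      ∑ x ∈ S, ∫ ω, constraint x ω * blockVar p {x} f ω ∂(μ k p) := by
  have hf : IsLocal f := ⟨S, hS⟩
  have e : (fun ω => f ω * -localGenerator p f ω) = fun ω =>
      ∑ x ∈ S, -(f ω * (constraint x ω * (siteMean p x f ω - f ω))) := by
    funext ω
    rw [localGenerator_eq_sum hS, Finset.sum_neg_distrib, ← Finset.mul_sum, mul_neg]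
  rw [e, integral_finsetSum]
  · exact Finset.sum_congr rfl fun x _ => by rw [integral_neg, integral_constraint_mul hf, neg_neg]
  · exact fun x _ =>
      ((hf.mul ((isLocal_constraint x).mul ((hf.siteMean p x).sub hf))).integrable p).neg

theorem variance_eq_blockVar {f : Config k → ℝ} {A : Finset (Vertex k)}
    (hf : DependsOn f (A : Set (Vertex k))) (ω : Config k) :
    variance f (μ k p) = blockVar p A f ω := by
  have hf2 : DependsOn (fun η => f η ^ 2) (A : Set (Vertex k)) := fun a b h => by
    simp only [hf h]
  rw [variance_eq_sub (IsLocal.memLp ⟨A, hf⟩ p), blockVar, ← integral_eq_blockMean hf,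
    ← integral_eq_blockMean hf2]
  rfl

/-- The Poincaré inequality for local functions. -/
theorem variance_le_of_isLocal (hk : 2 ≤ k) (hp : (p : ℝ) * k ≤ 1) {l : ℕ} (hl : 1 ≤ l)
    (hpl : ((p : ℝ) * k) ^ l * (l + 1) ≤ 4 / 5) {f : Config k → ℝ} (hf : IsLocal f) :
    variance f (μ k p) ≤ 90 * (l : ℝ) ^ 81 * ∫ ω, f ω * -localGenerator p f ω ∂(μ k p) := by
  obtain ⟨S, hS⟩ := hf
  obtain ⟨A, hSA, hchild, h⟩ := blockVar_le_of_local hk hp hl hpl hS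
  have hA : DependsOn f (A : Set (Vertex k)) := hS.mono (by exact_mod_cast hSA)
  rw [variance_eq_blockVar hA fun _ => false, integral_mul_localGenerator hS]
  refine (h _).trans (le_of_eq ?_)
  congr 1
  refine Finset.sum_congr rfl fun y hy => (integral_eq_blockMean ?_ _).symm
  intro ω ω' hω
  have h1 : constraint y ω = constraint y ω' := constraint_dependsOn y fun v hv => hω v (by
    obtain ⟨i, -, rfl⟩ := Finset.mem_image.1 hv
    exact hchild y hy i)
  have hA2 : DependsOn (fun η => f η ^ 2) (A : Set (Vertex k)) := fun a b h => by
    simp only [hA h]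
  have h2 : blockVar p {y} f ω = blockVar p {y} f ω' := by
    rw [blockVar, blockVar, (blockMean_dependsOn hA {y}).mono Set.sdiff_subset hω,
      (blockMean_dependsOn hA2 {y}).mono Set.sdiff_subset hω]
  simp only [h1, h2]

/-! ### From local functions to the closed generator -/

/-- The class in `L²(μ)` of a local function. -/
noncomputable def toL2 (p : I) {f : Config k → ℝ} (hf : IsLocal f) : L2 k p := (hf.memLp p).toLp f

theorem coeFn_toL2 {f : Config k → ℝ} (hf : IsLocal f) : toL2 p hf =ᵐ[μ k p] f :=
  (hf.memLp p).coeFn_toLp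

theorem inner_toL2 {f g : Config k → ℝ} (hf : IsLocal f) (hg : IsLocal g) :
    inner ℝ (toL2 p hf) (toL2 p hg) = ∫ ω, f ω * g ω ∂(μ k p) := by
  rw [L2.inner_def]
  refine integral_congr_ae ?_
  filter_upwards [coeFn_toL2 (p := p) hf, coeFn_toL2 (p := p) hg] with ω h1 h2
  rw [h1, h2]
  simp [mul_comm]

theorem norm_toL2_sq {f : Config k → ℝ} (hf : IsLocal f) :
    ‖toL2 p hf‖ ^ 2 = ∫ ω, f ω ^ 2 ∂(μ k p) := by
  rw [← real_inner_self_eq_norm_sq, inner_toL2]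
  simp only [sq]

/-- The constant function `1`. -/
noncomputable def oneL2 (k : ℕ) (p : I) : L2 k p := toL2 p (isLocal_const 1)

theorem oneL2_ne_zero : oneL2 k p ≠ 0 := fun h => by
  have h1 := norm_toL2_sq (k := k) (p := p) (isLocal_const 1)
  rw [← oneL2, h] at h1
  simp at h1

theorem inner_oneL2 (f : L2 k p) : inner ℝ (oneL2 k p) f = ∫ ω, f ω ∂(μ k p) := by
  rw [L2.inner_def]
  refine integral_congr_ae ?_
  filter_upwards [coeFn_toL2 (p := p) (isLocal_const (k := k) 1)] with ω h1
  rw [oneL2, h1]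
  simp

theorem variance_eq_inner (f : L2 k p) :
    variance f (μ k p) = inner ℝ f f - inner ℝ (oneL2 k p) f ^ 2 := by
  rw [variance_eq_sub (Lp.memLp f), inner_oneL2, L2.inner_def]
  congr 1
  refine integral_congr_ae (Filter.Eventually.of_forall fun ω => ?_)
  simp [sq]

theorem mem_generator_of_isLocal {f : Config k → ℝ} (hf : IsLocal f) :
    (toL2 p hf, toL2 p (isLocal_localGenerator hf p)) ∈ generator k p :=
  (localGraph k p).le_topologicalClosure ⟨f, hf, coeFn_toL2 hf,
    coeFn_toL2 (isLocal_localGenerator hf p)⟩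

theorem variance_toL2 {f : Config k → ℝ} (hf : IsLocal f) :
    variance (toL2 p hf) (μ k p) = variance f (μ k p) := variance_congr (coeFn_toL2 hf)

/-- Both sides are continuous on `L² × L²`, so the inequality survives the closure of the graph. -/
theorem variance_le_of_mem_generator {T : ℝ}
    (h : ∀ f : Config k → ℝ, IsLocal f →
      variance f (μ k p) ≤ T * ∫ ω, f ω * -localGenerator p f ω ∂(μ k p))
    {u : L2 k p × L2 k p} (hu : u ∈ generator k p) :
    variance u.1 (μ k p) ≤ T * inner ℝ u.1 (-u.2) := by
  have hclosed : IsClosed {u : L2 k p × L2 k p |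
      inner ℝ u.1 u.1 - inner ℝ (oneL2 k p) u.1 ^ 2 ≤ T * inner ℝ u.1 (-u.2)} := by
    refine isClosed_le ?_ ?_ <;> fun_prop
  rw [variance_eq_inner]
  refine (closure_minimal ?_ hclosed) hu
  rintro u ⟨f, hf, hf1, hf2⟩
  have e1 : u.1 = toL2 p hf := Lp.ext (hf1.trans (coeFn_toL2 hf).symm)
  have e2 : u.2 = toL2 p (isLocal_localGenerator hf p) := Lp.ext (hf2.trans (coeFn_toL2 _).symm)
  rw [Set.mem_ofPred_eq, ← variance_eq_inner, e1, e2, variance_toL2, inner_neg_right, inner_toL2,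
    ← integral_neg]
  simpa only [mul_neg] using h f hf

theorem ae_const_of_variance_eq_zero {f : L2 k p} (h : variance f (μ k p) = 0) :
    f =ᵐ[μ k p] fun _ => ∫ ω, f ω ∂(μ k p) := by
  have h1 := (Lp.memLp f).evariance_lt_top
  -- `variance` is a `toReal`, so it also vanishes when the extended variance is infinite; square
  -- integrability excludes this.
  rw [variance, ENNReal.toReal_eq_zero_iff] at h
  rcases h with h | h
  · exact (evariance_eq_zero_iff (Lp.aestronglyMeasurable f).aemeasurable).1 h
  · exact absurd h h1.ne

theorem variance_pos {f : L2 k p} (h : ¬ ∃ c : ℝ, f =ᵐ[μ k p] fun _ => c) :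
    0 < variance f (μ k p) :=
  (variance_nonneg _ _).lt_of_ne fun h0 => h ⟨_, ae_const_of_variance_eq_zero h0.symm⟩

theorem relaxationTime_le {T : ℝ} (hT : 0 < T)
    (h : ∀ f : Config k → ℝ, IsLocal f →
      variance f (μ k p) ≤ T * ∫ ω, f ω * -localGenerator p f ω ∂(μ k p)) :
    relaxationTime k p ≤ ENNReal.ofReal T := by
  rw [relaxationTime, ENNReal.inv_le_iff_inv_le, ← ENNReal.ofReal_inv_of_pos hT]
  refine le_iInf fun f => le_iInf fun g => le_iInf fun hfg => le_iInf fun hc => ?_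
  refine ENNReal.ofReal_le_ofReal ?_
  have h1 := variance_le_of_mem_generator h hfg
  rw [le_div_iff₀ (variance_pos hc), inv_mul_le_iff₀ hT]
  exact h1

theorem oneL2_mem_generatorKer : oneL2 k p ∈ generatorKer k p := by
  refine (localGraph k p).le_topologicalClosure ⟨fun _ => 1, isLocal_const 1,
    coeFn_toL2 (isLocal_const 1), ?_⟩
  have e : localGenerator p (fun _ : Config k => (1 : ℝ)) = 0 := funext fun ω => by
    rw [localGenerator_eq_sum (S := ∅) (fun _ _ _ => rfl)]
    simp
  rw [e]
  exact Lp.coeFn_zero _ _ _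

/-- A kernel element has zero Dirichlet form, hence zero variance. -/
theorem zeroIsSimpleEigenvalue_of_poincare {T : ℝ}
    (h : ∀ f : Config k → ℝ, IsLocal f →
      variance f (μ k p) ≤ T * ∫ ω, f ω * -localGenerator p f ω ∂(μ k p)) :
    ZeroIsSimpleEigenvalue k p := by
  refine finrank_eq_one (⟨oneL2 k p, oneL2_mem_generatorKer⟩ : generatorKer k p) ?_ ?_
  · exact fun h0 => oneL2_ne_zero (congrArg Subtype.val h0)
  · rintro ⟨f, hf⟩
    have h1 := variance_le_of_mem_generator h (u := (f, 0)) hf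
    simp only [neg_zero, inner_zero_right, mul_zero] at h1
    have h2 := ae_const_of_variance_eq_zero (le_antisymm h1 (variance_nonneg _ _))
    refine ⟨∫ ω, f ω ∂(μ k p), Subtype.ext (Lp.ext ?_)⟩
    refine (Lp.coeFn_smul _ _).trans ?_
    filter_upwards [h2, coeFn_toL2 (p := p) (isLocal_const (k := k) 1)] with ω h3 h4
    rw [Pi.smul_apply, oneL2, h4, h3]
    simp

/-! ### Occupied paths from the root -/

/-- The occupation variable at `x`. -/
def occ (x : Vertex k) (ω : Config k) : ℝ := if ω x = true then 1 else 0

/-- The indicator that all strict ancestors of `x` are occupied. -/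
def ancestorInd : Vertex k → Config k → ℝ
  | [], _ => 1
  | _ :: x, ω => occ x ω * ancestorInd x ω

/-- The indicator that the path from the root to `x` is occupied. -/
def pathInd (x : Vertex k) (ω : Config k) : ℝ := occ x ω * ancestorInd x ω

/-- The martingale increment at `x` of the cluster of the root. -/
def increment (p : I) (x : Vertex k) (ω : Config k) : ℝ := ancestorInd x ω * (occ x ω - p)

theorem occ_dependsOn (x : Vertex k) : DependsOn (occ x) {x} := fun ω ω' h => by
  simp [occ, h x rfl]

theorem ancestorInd_dependsOn (x : Vertex k) :
    DependsOn (ancestorInd x) {y | y <:+ x ∧ y ≠ x} := by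
  induction x with
  | nil => exact fun _ _ _ => rfl
  | cons i x ih =>
    intro ω ω' h
    have h1 : x ≠ i :: x := fun h => by simpa using congrArg List.length h
    simp only [ancestorInd]
    rw [occ_dependsOn x fun v hv => h v ?_, ih fun v hv => h v ⟨?_, ?_⟩]
    · exact hv.1.trans (List.suffix_cons i x)
    · rintro rfl
      have := hv.1.length_le
      simp at this
    · rw [Set.mem_singleton_iff.1 hv]
      exact ⟨List.suffix_cons i x, h1⟩

theorem pathInd_dependsOn (x : Vertex k) : DependsOn (pathInd x) {y | y <:+ x} := fun ω ω' h => by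
  rw [pathInd, pathInd, occ_dependsOn x fun v hv => h v ((Set.mem_singleton_iff.1 hv).symm ▸
    List.suffix_refl x),
    ancestorInd_dependsOn x fun v hv => h v hv.1]

theorem increment_dependsOn (x : Vertex k) : DependsOn (increment p x) {y | y <:+ x} :=
  fun ω ω' h => by
  rw [increment, increment, occ_dependsOn x fun v hv => h v ((Set.mem_singleton_iff.1 hv).symm ▸
    List.suffix_refl x),
    ancestorInd_dependsOn x fun v hv => h v hv.1]

theorem isLocal_of_suffix {f : Config k → ℝ} {x : Vertex k} (h : DependsOn f {y | y <:+ x}) :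
    IsLocal f :=
  ⟨x.tails.toFinset, h.mono fun y hy => by simpa using hy⟩

theorem isLocal_occ (x : Vertex k) : IsLocal (occ x) := ⟨{x}, by simpa using occ_dependsOn x⟩

theorem isLocal_ancestorInd (x : Vertex k) : IsLocal (ancestorInd x) :=
  isLocal_of_suffix ((ancestorInd_dependsOn x).mono fun _ h => h.1)

theorem isLocal_increment (p : I) (x : Vertex k) : IsLocal (increment p x) :=
  isLocal_of_suffix (increment_dependsOn x)

/-- `f` does not depend on the variable at `x`. -/
def FreeOf (x : Vertex k) (f : Config k → ℝ) : Prop :=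
  ∀ ω ω', AgreeOff {x} ω ω' → f ω' = f ω

theorem freeOf_of_dependsOn {f : Config k → ℝ} {S : Set (Vertex k)} {x : Vertex k}
    (h : DependsOn f S) (hx : x ∉ S) : FreeOf x f := fun _ _ hω =>
  h fun v hv => hω v fun hvx => hx (Finset.mem_singleton.1 hvx ▸ hv)

theorem FreeOf.mul {f g : Config k → ℝ} {x : Vertex k} (hf : FreeOf x f) (hg : FreeOf x g) :
    FreeOf x fun ω => f ω * g ω := fun ω ω' h => by simp only [hf ω ω' h, hg ω ω' h]

theorem FreeOf.siteMean_mul {f : Config k → ℝ} {x : Vertex k} (hf : FreeOf x f)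
    (g : Config k → ℝ) (ω : Config k) :
    siteMean p x (fun η => f η * g η) ω = f ω * siteMean p x g ω := by
  rw [← blockMean_singleton, ← blockMean_singleton, blockMean_mul_left (hf ω)]

theorem ancestorInd_freeOf (x : Vertex k) : FreeOf x (ancestorInd x) :=
  freeOf_of_dependsOn (ancestorInd_dependsOn x) fun h => h.2 rfl

theorem constraint_freeOf {x y : Vertex k} (h : ∀ i, i :: x ≠ y) : FreeOf y (constraint x) :=
  freeOf_of_dependsOn (constraint_dependsOn x) (by simpa using h)

theorem siteMean_comp_occ (x : Vertex k) (F : ℝ → ℝ) (ω : Config k) :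
    siteMean p x (fun η => F (occ x η)) ω = p * F 1 + (1 - p) * F 0 := by
  simp [siteMean_eq, occ]

theorem integral_mul_comp_occ {f : Config k → ℝ} {x : Vertex k} (hf : IsLocal f)
    (hx : FreeOf x f) (F : ℝ → ℝ) :
    ∫ ω, f ω * F (occ x ω) ∂(μ k p) = (p * F 1 + (1 - p) * F 0) * ∫ ω, f ω ∂(μ k p) := by
  have hl : IsLocal fun ω => f ω * F (occ x ω) := hf.comp₂ (isLocal_occ x) fun a b => a * F b
  rw [← integral_siteMean hl p x, mul_comm, ← integral_mul_const]
  congr 1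
  funext ω
  rw [hx.siteMean_mul, siteMean_comp_occ]

theorem integral_mul_sub_occ {f : Config k → ℝ} {x : Vertex k} (hf : IsLocal f)
    (hx : FreeOf x f) : ∫ ω, f ω * (occ x ω - p) ∂(μ k p) = 0 := by
  rw [integral_mul_comp_occ hf hx fun t => t - p]
  ring

theorem occ_sq (x : Vertex k) (ω : Config k) : occ x ω ^ 2 = occ x ω := by
  unfold occ; split_ifs <;> simp

theorem ancestorInd_sq (x : Vertex k) (ω : Config k) : ancestorInd x ω ^ 2 = ancestorInd x ω := by
  induction x with
  | nil => simp [ancestorInd]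
  | cons i x ih => simp only [ancestorInd]; rw [mul_pow, ih, occ_sq]

theorem integral_ancestorInd (x : Vertex k) :
    ∫ ω, ancestorInd x ω ∂(μ k p) = (p : ℝ) ^ x.length := by
  induction x with
  | nil => simp [ancestorInd]
  | cons i x ih =>
    have e : ancestorInd (i :: x) = fun ω => ancestorInd x ω * occ x ω := by
      funext ω; rw [ancestorInd, mul_comm]
    rw [e, integral_mul_comp_occ (isLocal_ancestorInd x) (ancestorInd_freeOf x) fun t => t, ih,
      List.length_cons, pow_succ]
    ring

theorem integral_increment_sq (x : Vertex k) :
    ∫ ω, increment p x ω ^ 2 ∂(μ k p) = p * (1 - p) * (p : ℝ) ^ x.length := by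
  have e : (fun ω => increment p x ω ^ 2) = fun ω => ancestorInd x ω * (occ x ω - p) ^ 2 := by
    funext ω; rw [increment, mul_pow, ancestorInd_sq]
  rw [e, integral_mul_comp_occ (isLocal_ancestorInd x) (ancestorInd_freeOf x) fun t => (t - p) ^ 2,
    integral_ancestorInd]
  ring

theorem integral_increment (x : Vertex k) : ∫ ω, increment p x ω ∂(μ k p) = 0 :=
  integral_mul_sub_occ (isLocal_ancestorInd x) (ancestorInd_freeOf x)

/-- Of two distinct vertices, one is not an ancestor of the other; its centred occupation variable
is independent of all the other factors. -/
theorem integral_increment_mul {x y : Vertex k} (h : x ≠ y) :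
    ∫ ω, increment p x ω * increment p y ω ∂(μ k p) = 0 := by
  wlog hyx : ¬ y <:+ x generalizing x y
  · have hxy : ¬ x <:+ y := fun hxy => h (hxy.eq_of_length
      (le_antisymm hxy.length_le (not_not.1 hyx).length_le))
    simpa only [mul_comm] using this h.symm hxy
  have e : (fun ω => increment p x ω * increment p y ω) = fun ω =>
      (increment p x ω * ancestorInd y ω) * (occ y ω - p) := by
    funext ω; rw [increment, increment]; ring
  rw [e]
  exact integral_mul_sub_occ ((isLocal_increment p x).mul (isLocal_ancestorInd y))
    (FreeOf.mul (freeOf_of_dependsOn (increment_dependsOn x) hyx) (ancestorInd_freeOf y))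

/-- On one level the constraints only look one level down, so they do not disturb the orthogonality
of the increments. -/
theorem integral_constraint_increment_mul {x y : Vertex k} (h : x ≠ y)
    (hl : x.length = y.length) :
    ∫ ω, constraint x ω * increment p x ω * (constraint y ω * increment p y ω) ∂(μ k p) = 0 := by
  have hyx : ¬ y <:+ x := fun hs => h (hs.eq_of_length hl.symm).symm
  have e : (fun ω => constraint x ω * increment p x ω * (constraint y ω * increment p y ω)) =
      fun ω => (constraint x ω * increment p x ω * (constraint y ω * ancestorInd y ω)) *
        (occ y ω - p) := by
    funext ω; simp only [increment]; ring
  rw [e]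
  have hc : ∀ z : Vertex k, z.length = y.length → FreeOf y (constraint z) := fun z hz =>
    constraint_freeOf fun i hi => by
      have := congrArg List.length hi
      simp at this
      omega
  exact integral_mul_sub_occ (((isLocal_constraint x).mul (isLocal_increment p x)).mul
      ((isLocal_constraint y).mul (isLocal_ancestorInd y)))
    (FreeOf.mul (FreeOf.mul (hc x hl) (freeOf_of_dependsOn (increment_dependsOn x) hyx))
      (FreeOf.mul (hc y rfl) (ancestorInd_freeOf y)))

theorem integral_sum_sq {ι : Type*} {s : Finset ι} {h : ι → Config k → ℝ}
    (hl : ∀ i ∈ s, IsLocal (h i))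
    (ho : ∀ i ∈ s, ∀ j ∈ s, i ≠ j → ∫ ω, h i ω * h j ω ∂(μ k p) = 0) :
    ∫ ω, (∑ i ∈ s, h i ω) ^ 2 ∂(μ k p) = ∑ i ∈ s, ∫ ω, h i ω ^ 2 ∂(μ k p) := by
  have e : (fun ω => (∑ i ∈ s, h i ω) ^ 2) = fun ω => ∑ i ∈ s, ∑ j ∈ s, h i ω * h j ω := by
    funext ω; rw [sq, Finset.sum_mul_sum]
  rw [e, integral_finsetSum]
  · refine Finset.sum_congr rfl fun i hi => ?_
    rw [integral_finsetSum, Finset.sum_eq_single i]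
    · simp only [sq]
    · exact fun j hj hji => ho i hi j hj hji.symm
    · exact fun h => absurd hi h
    · exact fun j hj => ((hl i hi).mul (hl j hj)).integrable p
  · exact fun i hi => (IsLocal.sum fun j hj => (hl i hi).mul (hl j hj)).integrable p

/-! ### Linear functionals of the cluster of the root -/

/-- The vertices at distance `n` from the root. -/
noncomputable def level (k n : ℕ) : Finset (Vertex k) :=
  (List.finite_length_eq (Fin k) n).toFinset

theorem mem_level {n : ℕ} {x : Vertex k} : x ∈ level k n ↔ x.length = n := by simp [level]

theorem sum_level_succ (n : ℕ) (F : Vertex k → ℝ) :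
    ∑ x ∈ level k (n + 1), F x = ∑ x ∈ level k n, ∑ i : Fin k, F (i :: x) := by
  rw [← Finset.sum_product']
  symm
  refine Finset.sum_bij (fun z _ => z.2 :: z.1) (fun z hz => ?_) (fun z _ z' _ h => ?_)
    (fun x hx => ?_) fun _ _ => rfl
  · rw [mem_level, List.length_cons, mem_level.1 (Finset.mem_product.1 hz).1]
  · exact Prod.ext (List.cons.inj h).2 (List.cons.inj h).1
  · rw [mem_level] at hx
    cases x with
    | nil => simp at hx
    | cons i x => exact ⟨(x, i), by simpa [mem_level] using hx, rfl⟩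

theorem level_zero : level k 0 = {[]} := by
  ext x; rw [mem_level]; simp

theorem card_level (n : ℕ) : ((level k n).card : ℝ) = (k : ℝ) ^ n := by
  induction n with
  | zero => simp [level_zero]
  | succ n ih =>
    have := sum_level_succ (k := k) n fun _ => 1
    simp only [Finset.sum_const, Finset.card_univ, Fintype.card_fin, nsmul_eq_mul, mul_one] at this
    rw [this, ih, pow_succ]

theorem sum_level_pathInd_zero (ω : Config k) :
    ∑ x ∈ level k 0, pathInd x ω = p + ∑ x ∈ level k 0, increment p x ω := by
  simp [level_zero, pathInd, increment, ancestorInd]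

theorem sum_level_pathInd_succ (n : ℕ) (ω : Config k) :
    ∑ x ∈ level k (n + 1), pathInd x ω =
      p * k * ∑ x ∈ level k n, pathInd x ω + ∑ x ∈ level k (n + 1), increment p x ω := by
  rw [sum_level_succ, sum_level_succ, Finset.mul_sum, ← Finset.sum_add_distrib]
  refine Finset.sum_congr rfl fun x _ => ?_
  have e : ∀ i : Fin k, pathInd (i :: x) ω = p * pathInd x ω + increment p (i :: x) ω := fun i => by
    simp only [pathInd, increment, ancestorInd]; ring
  simp only [e, Finset.sum_add_distrib, Finset.sum_const, Finset.card_univ, Fintype.card_fin,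
    nsmul_eq_mul]
  ring

/-- The functional `∑_{|x| ≤ n} a(|x|) 1{x is connected to the root}`. -/
noncomputable def cluster (a : ℕ → ℝ) (n : ℕ) (ω : Config k) : ℝ :=
  ∑ j ∈ Finset.range (n + 1), ∑ x ∈ level k j, a j * pathInd x ω

/-- The vertices at distance at most `n` from the root. -/
noncomputable def ball (k n : ℕ) : Finset (Vertex k) :=
  (Finset.range (n + 1)).biUnion (level k)

theorem mem_ball {n : ℕ} {x : Vertex k} : x ∈ ball k n ↔ x.length ≤ n := by
  simp [ball, mem_level]

theorem sum_ball (n : ℕ) (F : Vertex k → ℝ) :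
    ∑ x ∈ ball k n, F x = ∑ j ∈ Finset.range (n + 1), ∑ x ∈ level k j, F x := by
  refine Finset.sum_biUnion fun i _ j _ hij => Finset.disjoint_left.2 fun x hi hj => hij ?_
  rw [← mem_level.1 hi, mem_level.1 hj]

theorem cluster_eq_sum_ball (a : ℕ → ℝ) (n : ℕ) (ω : Config k) :
    cluster a n ω = ∑ x ∈ ball k n, a x.length * pathInd x ω := by
  rw [sum_ball]
  refine Finset.sum_congr rfl fun j _ => Finset.sum_congr rfl fun x hx => ?_
  rw [mem_level.1 hx]

theorem cluster_dependsOn (a : ℕ → ℝ) (n : ℕ) :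
    DependsOn (cluster (k := k) a n) (ball k n : Set (Vertex k)) := fun ω ω' h => by
  rw [cluster_eq_sum_ball, cluster_eq_sum_ball]
  refine Finset.sum_congr rfl fun x hx => ?_
  rw [pathInd_dependsOn x fun v hv => h v (mem_ball.2 (hv.length_le.trans (mem_ball.1 hx)))]

theorem isLocal_cluster (a : ℕ → ℝ) (n : ℕ) : IsLocal (cluster (k := k) a n) :=
  ⟨_, cluster_dependsOn a n⟩

theorem pathInd_eq_zero {x y : Vertex k} (h : y <:+ x) {ω : Config k} (hy : ω y = false) :
    pathInd x ω = 0 := by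
  induction x with
  | nil =>
    rw [List.suffix_nil.1 h] at hy
    simp [pathInd, occ, hy]
  | cons i x ih =>
    rcases List.suffix_cons_iff.1 h with rfl | h
    · simp [pathInd, occ, hy]
    · have := ih h
      simp only [pathInd, ancestorInd] at this ⊢
      rw [this, mul_zero]

theorem exists_child_suffix {x y : Vertex k} (h : x <:+ y) (hne : y ≠ x) :
    ∃ i : Fin k, i :: x <:+ y := by
  obtain ⟨t, rfl⟩ := h
  rcases List.eq_nil_or_concat t with rfl | ⟨s, i, rfl⟩
  · exact absurd rfl hne
  · exact ⟨i, s, by simp⟩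

/-- If `x` is a strict ancestor of `y`, the path to `y` passes through a child of `x`; where the
constraint holds this child is empty and the path is broken whatever the value at `x`. This is why
descendants contribute nothing to the Dirichlet form. -/
theorem constraint_mul_siteMean_pathInd (x y : Vertex k) (ω : Config k) :
    constraint x ω * (siteMean p x (pathInd y) ω - pathInd y ω) =
      if y = x then -(constraint x ω * increment p x ω) else 0 := by
  split_ifs with h
  · subst h
    have e : pathInd y = fun ω => ancestorInd y ω * occ y ω := by
      funext ω; rw [pathInd, mul_comm]
    rw [e, (ancestorInd_freeOf y).siteMean_mul, siteMean_comp_occ y fun t => t, increment]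
    ring
  · by_cases hs : x <:+ y
    · obtain ⟨i, hi⟩ := exists_child_suffix hs h
      by_cases hc : ω (i :: x) = false
      · have hne : i :: x ≠ x := fun h => by simpa using congrArg List.length h
        have hz : ∀ b, pathInd y (Function.update ω x b) = 0 := fun b =>
          pathInd_eq_zero hi (by rw [Function.update_of_ne hne, hc])
        rw [siteMean_eq, hz, hz, pathInd_eq_zero hi hc]
        ring
      · have : constraint x ω = 0 := if_neg fun h => hc (h i)
        rw [this, zero_mul]
    · have := blockMean_eq_self (p := p) (ω := ω) (freeOf_of_dependsOn (pathInd_dependsOn y) hs ω)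
      rw [blockMean_singleton] at this
      rw [this, sub_self, mul_zero]

theorem constraint_mul_siteMean_cluster (a : ℕ → ℝ) (n : ℕ) {x : Vertex k} (hx : x ∈ ball k n)
    (ω : Config k) :
    constraint x ω * (siteMean p x (cluster a n) ω - cluster a n ω) =
      -(a x.length * (constraint x ω * increment p x ω)) := by
  have e : cluster a n = fun ω => ∑ y ∈ ball k n, a y.length * pathInd y ω :=
    funext (cluster_eq_sum_ball a n)
  rw [e, ← blockMean_singleton, blockMean_sum]
  simp only [blockMean_const_mul, blockMean_singleton]
  rw [← Finset.sum_sub_distrib, Finset.mul_sum]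
  have : ∀ y ∈ ball k n, constraint x ω * (a y.length * siteMean p x (pathInd y) ω -
      a y.length * pathInd y ω) = if y = x then -(a x.length * (constraint x ω * increment p x ω))
        else 0 := fun y _ => by
    rw [← mul_sub, mul_left_comm, constraint_mul_siteMean_pathInd]
    split_ifs with h
    · rw [h, mul_neg]
    · rw [mul_zero]
  rw [Finset.sum_congr rfl this, Finset.sum_ite_eq' (ball k n) x, if_pos hx]

theorem localGenerator_cluster (a : ℕ → ℝ) (n : ℕ) (ω : Config k) :
    localGenerator p (cluster a n) ω =
      -∑ x ∈ ball k n, a x.length * (constraint x ω * increment p x ω) := by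
  rw [localGenerator_eq_sum (cluster_dependsOn a n), ← Finset.sum_neg_distrib]
  exact Finset.sum_congr rfl fun x hx => constraint_mul_siteMean_cluster a n hx ω

theorem constraint_sq (x : Vertex k) (ω : Config k) : constraint x ω ^ 2 = constraint x ω := by
  unfold constraint; split_ifs <;> simp

theorem constraint_le_one (x : Vertex k) (ω : Config k) : constraint x ω ≤ 1 := by
  unfold constraint; split_ifs <;> simp

theorem integral_constraint_increment_sq_le (x : Vertex k) :
    ∫ ω, (constraint x ω * increment p x ω) ^ 2 ∂(μ k p) ≤ p * (1 - p) * (p : ℝ) ^ x.length := by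
  rw [← integral_increment_sq]
  refine integral_mono ((((isLocal_constraint x).mul (isLocal_increment p x)).sq).integrable p)
    ((isLocal_increment p x).sq.integrable p) fun ω => ?_
  dsimp only
  rw [mul_pow, constraint_sq]
  exact mul_le_of_le_one_left (sq_nonneg _) (constraint_le_one x ω)

theorem integral_cluster_mul_localGenerator_le (a : ℕ → ℝ) (n : ℕ) :
    ∫ ω, cluster a n ω * -localGenerator p (cluster a n) ω ∂(μ k p) ≤
      p * (1 - p) * ∑ j ∈ Finset.range (n + 1), a j ^ 2 * ((p : ℝ) * k) ^ j := by
  rw [integral_mul_localGenerator (cluster_dependsOn a n)]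
  have h1 : ∀ x ∈ ball k n, ∫ ω, constraint x ω * blockVar p {x} (cluster a n) ω ∂(μ k p) ≤
      p * (1 - p) * (a x.length ^ 2 * (p : ℝ) ^ x.length) := by
    intro x hx
    have hl : IsLocal fun ω => (a x.length * (constraint x ω * increment p x ω)) ^ 2 :=
      ((isLocal_const (a x.length)).mul ((isLocal_constraint x).mul (isLocal_increment p x))).sq
    have e : ∀ ω, constraint x ω * blockVar p {x} (cluster a n) ω =
        blockMean p {x} (fun ω => (a x.length * (constraint x ω * increment p x ω)) ^ 2) ω := by
      intro ω
      have hc : ∀ ω', AgreeOff {x} ω ω' → constraint x ω' = constraint x ω :=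
        constraint_freeOf (fun i h => by simpa using congrArg List.length h) ω
      rw [blockVar_eq_sub_sq, ← blockMean_mul_left hc]
      refine blockMean_congr fun ω' _ => ?_
      rw [← neg_sq (a x.length * _), ← constraint_mul_siteMean_cluster a n hx, mul_pow,
        constraint_sq, blockMean_singleton]
      ring
    rw [funext e, integral_blockMean hl]
    simp only [mul_pow (a x.length), integral_const_mul]
    have := mul_le_mul_of_nonneg_left (integral_constraint_increment_sq_le (p := p) x)
      (sq_nonneg (a x.length))
    linarith
  refine (Finset.sum_le_sum h1).trans (le_of_eq ?_)
  rw [← Finset.mul_sum, sum_ball]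
  congr 1
  refine Finset.sum_congr rfl fun j _ => ?_
  rw [Finset.sum_congr rfl fun x hx => by rw [mem_level.1 hx], Finset.sum_const, nsmul_eq_mul,
    card_level, mul_pow]
  ring

/-- By orthogonality of the increments; level `j` has `k ^ j` vertices whose ancestors are all
occupied with probability `p ^ j`. -/
theorem integral_sum_increment_sq (b : ℕ → ℝ) (s : Finset ℕ) :
    ∫ ω, (∑ j ∈ s, ∑ x ∈ level k j, b j * increment p x ω) ^ 2 ∂(μ k p) =
      p * (1 - p) * ∑ j ∈ s, b j ^ 2 * ((p : ℝ) * k) ^ j := by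
  have e : ∀ ω : Config k, ∑ j ∈ s, ∑ x ∈ level k j, b j * increment p x ω =
      ∑ x ∈ s.biUnion (level k), b x.length * increment p x ω := fun ω => by
    rw [Finset.sum_biUnion fun i _ j _ hij => Finset.disjoint_left.2 fun x hi hj => hij (by
      rw [← mem_level.1 hi, mem_level.1 hj])]
    exact Finset.sum_congr rfl fun j _ => Finset.sum_congr rfl fun x hx => by rw [mem_level.1 hx]
  simp only [e]
  rw [integral_sum_sq (fun x _ => (isLocal_const (b x.length)).mul (isLocal_increment p x)),
    Finset.sum_biUnion fun i _ j _ hij => Finset.disjoint_left.2 fun x hi hj => hij (by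
      rw [← mem_level.1 hi, mem_level.1 hj]), Finset.mul_sum]
  · refine Finset.sum_congr rfl fun j _ => ?_
    rw [Finset.sum_congr rfl (g := fun _ => b j ^ 2 * (p * (1 - p) * (p : ℝ) ^ j)) fun x hx => by
      simp only [mul_pow, integral_const_mul, integral_increment_sq, mem_level.1 hx],
      Finset.sum_const, nsmul_eq_mul, card_level, mul_pow]
    ring
  · intro x _ y _ hxy
    have : ∀ ω, b x.length * increment p x ω * (b y.length * increment p y ω) =
        b x.length * b y.length * (increment p x ω * increment p y ω) := fun ω => by ring
    simp only [this, integral_const_mul, integral_increment_mul hxy, mul_zero]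

/-! ### The lower bound on the relaxation time -/

theorem le_relaxationTime {f : Config k → ℝ} (hf : IsLocal f) (hv : 0 < variance f (μ k p))
    {g : ℝ} (hg : 0 < g)
    (h : ∫ ω, f ω * -localGenerator p f ω ∂(μ k p) ≤ g * variance f (μ k p)) :
    ENNReal.ofReal g⁻¹ ≤ relaxationTime k p := by
  rw [relaxationTime, ENNReal.ofReal_inv_of_pos hg, ENNReal.inv_le_inv]
  have hc : ¬ ∃ c : ℝ, toL2 p hf =ᵐ[μ k p] fun _ => c := by
    rintro ⟨c, hc⟩
    have := variance_congr hc
    rw [variance_toL2] at this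
    rw [this] at hv
    simp [variance_eq_integral measurable_const.aemeasurable] at hv
  refine (iInf_le_of_le (toL2 p hf) (iInf_le_of_le (toL2 p (isLocal_localGenerator hf p))
    (iInf_le_of_le (mem_generator_of_isLocal hf) (iInf_le_of_le hc le_rfl)))).trans
    (ENNReal.ofReal_le_ofReal ?_)
  rw [variance_toL2, div_le_iff₀ hv, inner_neg_right, inner_toL2, ← integral_neg]
  simpa only [mul_neg] using h

/-- The weight `ε⁻¹` on the last level stands for the mean total progeny of each of its occupied
vertices. It makes the truncated cluster size an exact martingale sum with constant coefficients. -/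
theorem cluster_eq_of_subcritical {ε : ℝ} (hε : 0 < ε) (hpk : (p : ℝ) * k = 1 - ε) (n : ℕ)
    (ω : Config k) :
    cluster (fun j => if j < n then 1 else ε⁻¹) n ω = p * ε⁻¹ +
      ∑ j ∈ Finset.range (n + 1), ∑ x ∈ level k j, ε⁻¹ * increment p x ω := by
  have e : cluster (fun j => if j < n then 1 else ε⁻¹) n ω =
      ∑ j ∈ Finset.range n, ∑ x ∈ level k j, pathInd x ω +
        ε⁻¹ * ∑ x ∈ level k n, pathInd x ω := by
    rw [cluster, Finset.sum_range_succ, Finset.mul_sum]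
    congr 1
    · refine Finset.sum_congr rfl fun j hj => Finset.sum_congr rfl fun x _ => ?_
      rw [if_pos (Finset.mem_range.1 hj), one_mul]
    · simp
  rw [e]
  clear e
  induction n with
  | zero =>
    rw [sum_level_pathInd_zero (p := p)]
    simp only [Finset.range_zero, Finset.sum_empty, zero_add, Finset.sum_range_one,
      ← Finset.mul_sum]
    ring
  | succ n ih =>
    rw [Finset.sum_range_succ _ (n + 1), ← add_assoc, ← ih, Finset.sum_range_succ,
      sum_level_pathInd_succ (p := p), hpk, ← Finset.mul_sum]
    field_simp
    ring

theorem variance_const_add_sum_increment (c : ℝ) (b : ℕ → ℝ) (s : Finset ℕ) :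
    variance (fun ω => c + ∑ j ∈ s, ∑ x ∈ level k j, b j * increment p x ω) (μ k p) =
      p * (1 - p) * ∑ j ∈ s, b j ^ 2 * ((p : ℝ) * k) ^ j := by
  have hl' : ∀ j ∈ s, IsLocal fun ω => ∑ x ∈ level k j, b j * increment p x ω := fun j _ =>
    IsLocal.sum fun x _ => (isLocal_const (b j)).mul (isLocal_increment p x)
  have hl : IsLocal fun ω => ∑ j ∈ s, ∑ x ∈ level k j, b j * increment p x ω := IsLocal.sum hl'
  rw [variance_const_add hl.measurable.aestronglyMeasurable, variance_eq_sub (hl.memLp p)]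
  have h0 : ∫ ω, ∑ j ∈ s, ∑ x ∈ level k j, b j * increment p x ω ∂(μ k p) = 0 := by
    rw [integral_finsetSum _ fun j hj => (hl' j hj).integrable p]
    refine Finset.sum_eq_zero fun j _ => ?_
    rw [integral_finsetSum _ fun x _ =>
      ((isLocal_const (b j)).mul (isLocal_increment p x)).integrable p]
    exact Finset.sum_eq_zero fun x _ => by rw [integral_const_mul, integral_increment, mul_zero]
  rw [h0, ← integral_sum_increment_sq]
  simp

theorem le_relaxationTime_of_subcritical (hp0 : 0 < (p : ℝ)) (hp1 : (p : ℝ) < 1) {ε : ℝ}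
    (hε : 0 < ε) (hpk : (p : ℝ) * k = 1 - ε) :
    ENNReal.ofReal (2 * ε ^ 2)⁻¹ ≤ relaxationTime k p := by
  have hq : 0 < 1 - (p : ℝ) := by linarith
  have hl0 : 0 ≤ (p : ℝ) * k := by positivity
  -- The truncation level is so deep that the last level contributes at most `1` to the Dirichlet
  -- sum, no more than the term `j = 0` of the geometric sum.
  obtain ⟨n, hn⟩ := exists_pow_lt_of_lt_one (by positivity : 0 < ε ^ 2)
    (by linarith : (p : ℝ) * k < 1)
  set a : ℕ → ℝ := fun j => if j < n then 1 else ε⁻¹ with ha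
  have hvar : variance (cluster (k := k) a n) (μ k p) =
      p * (1 - p) * ∑ j ∈ Finset.range (n + 1), ε⁻¹ ^ 2 * ((p : ℝ) * k) ^ j := by
    rw [funext (cluster_eq_of_subcritical hε hpk n)]
    exact variance_const_add_sum_increment _ (fun _ => ε⁻¹) _
  rw [← Finset.mul_sum] at hvar
  have hD := integral_cluster_mul_localGenerator_le (k := k) (p := p) a n
  have hsum : 1 ≤ ∑ j ∈ Finset.range (n + 1), ((p : ℝ) * k) ^ j := by
    rw [Finset.sum_range_succ']
    simp only [pow_zero]
    linarith [Finset.sum_nonneg fun j (_ : j ∈ Finset.range n) => pow_nonneg hl0 (j + 1)]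
  have hDsum : ∑ j ∈ Finset.range (n + 1), a j ^ 2 * ((p : ℝ) * k) ^ j ≤
      2 * ∑ j ∈ Finset.range (n + 1), ((p : ℝ) * k) ^ j := by
    have h1 : ∑ j ∈ Finset.range (n + 1), a j ^ 2 * ((p : ℝ) * k) ^ j =
        ∑ j ∈ Finset.range n, ((p : ℝ) * k) ^ j + ε⁻¹ ^ 2 * ((p : ℝ) * k) ^ n := by
      rw [Finset.sum_range_succ]
      congr 1
      · refine Finset.sum_congr rfl fun j hj => ?_
        simp [ha, Finset.mem_range.1 hj]
      · simp [ha]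
    have h2 : ε⁻¹ ^ 2 * ((p : ℝ) * k) ^ n ≤ 1 := by
      rw [inv_pow, inv_mul_le_iff₀ (by positivity)]
      linarith
    have h3 : ∑ j ∈ Finset.range n, ((p : ℝ) * k) ^ j ≤
        ∑ j ∈ Finset.range (n + 1), ((p : ℝ) * k) ^ j := by
      rw [Finset.sum_range_succ]
      linarith [pow_nonneg hl0 n]
    linarith
  refine le_relaxationTime (isLocal_cluster a n) ?_ (by positivity) (hD.trans ?_)
  · rw [hvar]
    positivity
  · rw [hvar]
    have : 2 * ε ^ 2 * (p * (1 - p) * (ε⁻¹ ^ 2 * ∑ j ∈ Finset.range (n + 1), ((p : ℝ) * k) ^ j)) =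
        p * (1 - p) * (2 * ∑ j ∈ Finset.range (n + 1), ((p : ℝ) * k) ^ j) := by
      field_simp
    rw [this]
    exact mul_le_mul_of_nonneg_left hDsum (by positivity)

/-! ### The supercritical regime -/

/-- The increments of the martingale `Z_n / (pk)^n`, `Z_n` being the size of level `n` of the
cluster of the root. -/
noncomputable def scaledIncrement (p : I) (n : ℕ) (ω : Config k) : ℝ :=
  ∑ j ∈ {n}, ∑ x ∈ level k j, ((p : ℝ) * k)⁻¹ ^ j * increment p x ω

theorem isLocal_scaledIncrement (p : I) (n : ℕ) : IsLocal (scaledIncrement (k := k) p n) :=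
  IsLocal.sum fun j _ => IsLocal.sum fun x _ =>
    (isLocal_const (((p : ℝ) * k)⁻¹ ^ j)).mul (isLocal_increment p x)

theorem scaledIncrement_eq (n : ℕ) (ω : Config k) :
    scaledIncrement p n ω = ∑ x ∈ level k n, ((p : ℝ) * k)⁻¹ ^ n * increment p x ω := by
  rw [scaledIncrement, Finset.sum_singleton]

theorem norm_scaledIncrement_sq (hp : 0 < (p : ℝ) * k) (n : ℕ) :
    ‖toL2 p (isLocal_scaledIncrement (k := k) p n)‖ ^ 2 =
      p * (1 - p) * ((p : ℝ) * k)⁻¹ ^ n := by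
  rw [norm_toL2_sq]
  -- The outer sum over `{n}` in the definition lets the general second-moment formula apply
  -- directly.
  unfold scaledIncrement
  rw [integral_sum_increment_sq (k := k) (fun j => ((p : ℝ) * k)⁻¹ ^ j) {n}, Finset.sum_singleton,
    sq, mul_assoc (_ ^ n), ← mul_pow _ ((p : ℝ) * k), inv_mul_cancel₀ hp.ne', one_pow, mul_one]

theorem cluster_eq_sum_scaledIncrement (hp : 0 < (p : ℝ) * k) (n : ℕ) (ω : Config k) :
    cluster (fun j => if j = n then ((p : ℝ) * k)⁻¹ ^ n else 0) n ω =
      p + ∑ j ∈ Finset.range (n + 1), scaledIncrement p j ω := by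
  have e : cluster (fun j => if j = n then ((p : ℝ) * k)⁻¹ ^ n else 0) n ω =
      ((p : ℝ) * k)⁻¹ ^ n * ∑ x ∈ level k n, pathInd x ω := by
    rw [cluster, Finset.sum_range_succ, Finset.mul_sum, Finset.sum_eq_zero, zero_add]
    · simp
    · intro j hj
      simp [(Finset.mem_range.1 hj).ne]
  rw [e]
  clear e
  induction n with
  | zero =>
    rw [sum_level_pathInd_zero (p := p)]
    simp [scaledIncrement_eq]
  | succ n ih =>
    rw [Finset.sum_range_succ, ← add_assoc, ← ih, sum_level_pathInd_succ (p := p),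
      scaledIncrement_eq, mul_add, ← Finset.mul_sum]
    congr 1
    rw [pow_succ, mul_assoc, ← mul_assoc _⁻¹, inv_mul_cancel₀ hp.ne', one_mul]

/-- The generator turns `Z_n` into a sum of constrained increments over level `n` alone. These are
orthogonal, so the squared norm is of order `(p * k) ^ n`, and the normalization contributes `(p *
k)⁻¹ ^ (2 * n)`. -/
theorem norm_localGenerator_cluster_sq_le (hp : 0 < (p : ℝ) * k) (n : ℕ) :
    ‖toL2 p (isLocal_localGenerator (isLocal_cluster (k := k)
      (fun j => if j = n then ((p : ℝ) * k)⁻¹ ^ n else 0) n) p)‖ ^ 2 ≤ ((p : ℝ) * k)⁻¹ ^ n := by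
  have hp0 := p.2.1
  have hp1 := p.2.2
  have e : ∀ ω : Config k,
      localGenerator p (cluster (fun j => if j = n then ((p : ℝ) * k)⁻¹ ^ n else 0) n) ω ^ 2 =
      (((p : ℝ) * k)⁻¹ ^ n) ^ 2 * (∑ x ∈ level k n, constraint x ω * increment p x ω) ^ 2 := by
    intro ω
    rw [localGenerator_cluster, neg_sq, sum_ball, Finset.sum_range_succ, Finset.sum_eq_zero,
      zero_add, ← mul_pow, Finset.mul_sum]
    · congr 1
      exact Finset.sum_congr rfl fun x hx => by rw [if_pos (mem_level.1 hx)]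
    · intro j hj
      refine Finset.sum_eq_zero fun x hx => ?_
      rw [mem_level.1 hx, if_neg (Finset.mem_range.1 hj).ne, zero_mul]
  rw [norm_toL2_sq]
  simp only [e, integral_const_mul]
  rw [integral_sum_sq (fun x _ => (isLocal_constraint x).mul (isLocal_increment p x))
    fun x hx y hy hxy => integral_constraint_increment_mul hxy
      ((mem_level.1 hx).trans (mem_level.1 hy).symm)]
  have h1 : ∑ x ∈ level k n, ∫ ω, (constraint x ω * increment p x ω) ^ 2 ∂(μ k p) ≤
      ((p : ℝ) * k) ^ n := by
    calc _ ≤ ∑ x ∈ level k n, (p : ℝ) ^ n := Finset.sum_le_sum fun x hx => by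
          have := integral_constraint_increment_sq_le (p := p) x
          rw [mem_level.1 hx] at this
          refine this.trans (mul_le_of_le_one_left (by positivity) ?_)
          nlinarith
      _ = _ := by rw [Finset.sum_const, nsmul_eq_mul, card_level, mul_pow, mul_comm]
  refine (mul_le_mul_of_nonneg_left h1 (sq_nonneg _)).trans (le_of_eq ?_)
  rw [sq, mul_assoc, ← mul_pow, inv_mul_cancel₀ hp.ne', one_pow, mul_one]

theorem inner_scaledIncrement (n : ℕ) (hn : n ≠ 0) :
    inner ℝ (toL2 p (isLocal_scaledIncrement (k := k) p 0))
      (toL2 p (isLocal_scaledIncrement (k := k) p n)) = 0 := by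
  rw [inner_toL2]
  simp only [scaledIncrement_eq, level_zero, Finset.sum_singleton, Finset.mul_sum]
  rw [integral_finsetSum]
  · refine Finset.sum_eq_zero fun x hx => ?_
    have hne : ([] : Vertex k) ≠ x := fun h => hn (by rw [← mem_level.1 hx, ← h]; rfl)
    have : ∀ ω, ((p : ℝ) * k)⁻¹ ^ 0 * increment p [] ω * (((p : ℝ) * k)⁻¹ ^ n * increment p x ω) =
        ((p : ℝ) * k)⁻¹ ^ n * (increment p [] ω * increment p x ω) := fun ω => by ring
    simp only [this, integral_const_mul, integral_increment_mul hne, mul_zero]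
  · exact fun x _ => ((((isLocal_const _).mul (isLocal_increment p []))).mul
      ((isLocal_const _).mul (isLocal_increment p x))).integrable p

theorem inner_oneL2_scaledIncrement (n : ℕ) :
    inner ℝ (toL2 p (isLocal_scaledIncrement (k := k) p n)) (oneL2 k p) = 0 := by
  rw [oneL2, inner_toL2]
  simp only [scaledIncrement_eq, mul_one]
  rw [integral_finsetSum _ fun x _ => ((isLocal_const _).mul (isLocal_increment p x)).integrable p]
  exact Finset.sum_eq_zero fun x _ => by rw [integral_const_mul, integral_increment, mul_zero]

theorem not_zeroIsSimpleEigenvalue (hp1 : (p : ℝ) < 1) (hpk : 1 < (p : ℝ) * k) :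
    ¬ ZeroIsSimpleEigenvalue k p := by
  intro hsimple
  have hpk0 : 0 < (p : ℝ) * k := by linarith
  have hp0 : 0 < (p : ℝ) := pos_of_mul_pos_left hpk0 (Nat.cast_nonneg k)
  have hr0 : 0 ≤ ((p : ℝ) * k)⁻¹ := by positivity
  have hr1 : ((p : ℝ) * k)⁻¹ < 1 := inv_lt_one_of_one_lt₀ hpk
  set J : ℕ → L2 k p := fun n => toL2 p (isLocal_scaledIncrement (k := k) p n) with hJ
  have hJle : ∀ n, ‖J n‖ ≤ √((p : ℝ) * k)⁻¹ ^ n := fun n => by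
    refine le_of_sq_le_sq ?_ (by positivity)
    rw [norm_scaledIncrement_sq hpk0, ← pow_mul, mul_comm n 2, pow_mul, Real.sq_sqrt hr0]
    exact mul_le_of_le_one_left (by positivity) (by nlinarith)
  have hsum : Summable J := Summable.of_norm_bounded
    (summable_geometric_of_lt_one (Real.sqrt_nonneg _) (by
      rw [Real.sqrt_lt' one_pos]; simpa using hr1)) hJle
  obtain ⟨M, hM⟩ := hsum
  set F : ℕ → Config k → ℝ := fun n =>
    cluster (fun j => if j = n then ((p : ℝ) * k)⁻¹ ^ n else 0) n with hF
  have hFl : ∀ n, IsLocal (F n) := fun n => isLocal_cluster _ n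
  have hFe : ∀ n, toL2 p (hFl n) = (p : ℝ) • oneL2 k p + ∑ j ∈ Finset.range (n + 1), J j := by
    intro n
    refine Lp.ext ((coeFn_toL2 (hFl n)).trans ?_)
    have h1 : ∀ s : Finset ℕ, ((∑ j ∈ s, J j : L2 k p) : Config k → ℝ) =ᵐ[μ k p]
        fun ω => ∑ j ∈ s, scaledIncrement p j ω := fun s => by
      induction s using Finset.induction_on with
      | empty =>
        simp only [Finset.sum_empty]
        exact Lp.coeFn_zero ℝ 2 (μ k p)
      | insert a s ha ih =>
        rw [Finset.sum_insert ha]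
        filter_upwards [Lp.coeFn_add (J a) (∑ j ∈ s, J j), ih,
          coeFn_toL2 (p := p) (isLocal_scaledIncrement (k := k) p a)] with ω h2 h3 h4
        rw [h2, Pi.add_apply, h3, Finset.sum_insert ha, hJ, h4]
    filter_upwards [Lp.coeFn_add ((p : ℝ) • oneL2 k p) (∑ j ∈ Finset.range (n + 1), J j),
      h1 (Finset.range (n + 1)), Lp.coeFn_smul (p : ℝ) (oneL2 k p),
      coeFn_toL2 (p := p) (isLocal_const (k := k) 1)] with ω h2 h3 h4 h5
    rw [h2, Pi.add_apply, h3, h4, Pi.smul_apply, oneL2, h5]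
    simp only [hF, cluster_eq_sum_scaledIncrement hpk0, smul_eq_mul, mul_one]
  set N : L2 k p := (p : ℝ) • oneL2 k p + M with hN
  have hlim : Filter.Tendsto (fun n => toL2 p (hFl n)) Filter.atTop (nhds N) := by
    simp only [hFe]
    exact tendsto_const_nhds.add
      (hM.tendsto_sum_nat.comp (Filter.tendsto_add_atTop_nat 1))
  have hlim' : Filter.Tendsto (fun n => toL2 p (isLocal_localGenerator (hFl n) p))
      Filter.atTop (nhds 0) := by
    rw [tendsto_zero_iff_norm_tendsto_zero]
    have h1 : Filter.Tendsto (fun n : ℕ => √(((p : ℝ) * k)⁻¹ ^ n)) Filter.atTop (nhds 0) := by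
      have := (Real.continuous_sqrt.tendsto 0).comp (tendsto_pow_atTop_nhds_zero_of_lt_one hr0 hr1)
      rwa [Real.sqrt_zero] at this
    refine squeeze_zero (fun _ => norm_nonneg _) (fun n => ?_) h1
    exact Real.le_sqrt_of_sq_le (norm_localGenerator_cluster_sq_le hpk0 n)
  -- The functions converge to `N` and their images to `0`, so `(N, 0)` lies in the closed graph.
  have hker : N ∈ generatorKer k p :=
    (localGraph k p).isClosed_topologicalClosure.mem_of_tendsto (hlim.prodMk_nhds hlim')
      (Filter.Eventually.of_forall fun n => mem_generator_of_isLocal (hFl n))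
  obtain ⟨c, hc⟩ := (finrank_eq_one_iff_of_nonzero' (⟨oneL2 k p, oneL2_mem_generatorKer⟩ :
    generatorKer k p) (fun h0 => oneL2_ne_zero (congrArg Subtype.val h0))).1 hsimple ⟨N, hker⟩
  have hc' : c • oneL2 k p = N := congrArg Subtype.val hc
  -- `J 0` separates `N` from the constants: it is orthogonal to them, while its inner product with
  -- `N` is `‖J 0‖ ^ 2 > 0`.
  have h1 : inner ℝ (J 0) N = 0 := by
    rw [← hc', inner_smul_right, inner_oneL2_scaledIncrement, mul_zero]
  have h2 : ∀ n, inner ℝ (J 0) (toL2 p (hFl n)) = ‖J 0‖ ^ 2 := fun n => by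
    rw [hFe, inner_add_right, inner_smul_right, inner_oneL2_scaledIncrement, mul_zero, zero_add,
      inner_sum, Finset.sum_range_succ', Finset.sum_eq_zero fun j _ =>
        inner_scaledIncrement (j + 1) (Nat.succ_ne_zero j), zero_add, real_inner_self_eq_norm_sq]
  have h3 : inner ℝ (J 0) N = ‖J 0‖ ^ 2 := by
    refine tendsto_nhds_unique (Filter.Tendsto.inner tendsto_const_nhds hlim) ?_
    simp only [h2]
    exact tendsto_const_nhds
  rw [h1, hJ, norm_scaledIncrement_sq hpk0] at h3
  have : 0 < (p : ℝ) * (1 - p) := mul_pos hp0 (by linarith)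
  simp at h3
  rcases h3 with h3 | h3
  · rw [h3] at hp0
    simp at hp0
  · linarith

/-! ### The critical density and the bounds on the relaxation time -/

theorem exists_poincare (hk : 2 ≤ k) {ε : ℝ} (hε : 0 < ε) (hε1 : ε ≤ 1)
    (hpk : (p : ℝ) * k = 1 - ε) (f : Config k → ℝ) (hf : IsLocal f) :
    variance f (μ k p) ≤ 90 * (9 / ε ^ 2) ^ 81 *
      ∫ ω, f ω * -localGenerator p f ω ∂(μ k p) := by
  have hl := Nat.le_ceil (8 / ε ^ 2)
  have hl2 := (Nat.ceil_lt_add_one (by positivity : 0 ≤ 8 / ε ^ 2)).le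
  set l := ⌈8 / ε ^ 2⌉₊ with hldef
  have hε2 : ε ^ 2 ≤ 1 := pow_le_one₀ hε.le hε1
  have hl1 : 1 ≤ l := Nat.ceil_pos.2 (by positivity)
  have hl9 : (l : ℝ) ≤ 9 / ε ^ 2 := by
    have : 1 ≤ 1 / ε ^ 2 := by rw [le_div_iff₀ (by positivity)]; linarith
    have e : 9 / ε ^ 2 = 8 / ε ^ 2 + 1 / ε ^ 2 := by ring
    linarith
  refine (variance_le_of_isLocal hk (by linarith) hl1
    (by rw [hpk]; exact one_sub_pow_mul_le hε hε1 hl) hf).trans ?_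
  refine mul_le_mul_of_nonneg_right ?_ ?_
  · gcongr
  · obtain ⟨S, hS⟩ := hf
    rw [integral_mul_localGenerator hS]
    exact Finset.sum_nonneg fun x _ => integral_nonneg fun ω =>
      mul_nonneg (constraint_nonneg x ω) (blockVar_nonneg _ _ _)

theorem criticalDensity_eq (hk : 2 ≤ k) : criticalDensity k = 1 / k := by
  have hk' : (2 : ℝ) ≤ k := by exact_mod_cast hk
  have hk0 : (0 : ℝ) < k := by linarith
  have hmem : ∀ r : ℝ, 0 < r → r < 1 / k →
      r ∈ {r : ℝ | ∃ p : I, (p : ℝ) = r ∧ r < 1 ∧ ZeroIsSimpleEigenvalue k p} := by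
    intro r hr0 hr
    have h1 : (1 : ℝ) / k < 1 := by rw [div_lt_one hk0]; linarith
    have h2 : r * k < 1 := (lt_div_iff₀ hk0).1 hr
    refine ⟨⟨r, hr0.le, (hr.trans h1).le⟩, rfl, hr.trans h1, ?_⟩
    exact zeroIsSimpleEigenvalue_of_poincare (exists_poincare hk (ε := 1 - r * k) (by linarith)
      (by nlinarith) (by simp))
  refine csSup_eq_of_forall_le_of_forall_lt_exists_gt ⟨1 / k / 2, hmem _ (by positivity)
    (half_lt_self (by positivity))⟩ ?_ ?_
  · rintro r ⟨p, rfl, hp1, hs⟩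
    by_contra h
    exact not_zeroIsSimpleEigenvalue hp1 ((div_lt_iff₀ hk0).1 (not_le.1 h)) hs
  · intro w hw
    obtain ⟨r, h1, h2⟩ := exists_between (max_lt hw (by positivity : (0 : ℝ) < 1 / k))
    exact ⟨r, hmem r ((le_max_right _ _).trans_lt h1) h2, (le_max_left _ _).trans_lt h1⟩

end OFA

theorem theorem2 :
    ∃ α : ℝ, 0 ≤ α ∧ ∀ k : ℕ, 2 ≤ k → ∃ a : ℝ, 0 < a ∧
      ∀ p : unitInterval, 0 < (p : ℝ) → (p : ℝ) < OFA.criticalDensity k →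
        ENNReal.ofReal (a⁻¹ * (OFA.criticalDensity k - p) ^ (-2 : ℝ)) ≤ OFA.relaxationTime k p ∧
        OFA.relaxationTime k p ≤
          ENNReal.ofReal (a * (OFA.criticalDensity k - p) ^ (-(2 + α))) := by
  -- With `ε = k * δ` the Poincaré constant is `90 * (9 / ε ^ 2) ^ 81`, so the exponent is `162 = 2
  -- + 160`. In `a`, the term `2 * k ^ 2` serves the lower bound `(2 * ε ^ 2)⁻¹`, and `90 * 9 ^ 81`
  -- serves the upper one, where `δ ≤ k * δ` removes `k`.
  refine ⟨160, by norm_num, fun k hk => ⟨2 * k ^ 2 + 90 * 9 ^ 81, by positivity, fun p hp0 hp => ?_⟩⟩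
  rw [OFA.criticalDensity_eq hk] at hp ⊢
  have hk' : (2 : ℝ) ≤ k := by exact_mod_cast hk
  have hk0 : (0 : ℝ) < k := by linarith
  set δ : ℝ := 1 / k - p with hδ
  have hδ0 : 0 < δ := by linarith
  have hpk : (p : ℝ) * k = 1 - k * δ := by rw [hδ, mul_sub, mul_one_div_cancel hk0.ne']; ring
  have hpk0 : 0 < (p : ℝ) * k := by positivity
  have hε0 : 0 < k * δ := by positivity
  have hε1 : k * δ ≤ 1 := by linarith
  have hp1 : (p : ℝ) < 1 := hp.trans (by rw [div_lt_one hk0]; linarith)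
  have e1 : δ ^ (-2 : ℝ) = (δ ^ 2)⁻¹ := by
    rw [Real.rpow_neg hδ0.le]; norm_cast
  have e2 : δ ^ (-(2 + 160) : ℝ) = (δ ^ 162)⁻¹ := by
    rw [Real.rpow_neg hδ0.le]; norm_num
  rw [e1, e2]
  constructor
  · refine (ENNReal.ofReal_le_ofReal ?_).trans
      (OFA.le_relaxationTime_of_subcritical hp0 hp1 hε0 hpk)
    rw [← mul_inv]
    refine inv_anti₀ (by positivity) ?_
    rw [mul_pow, ← mul_assoc]
    exact mul_le_mul_of_nonneg_right (by linarith [show (0 : ℝ) ≤ 90 * 9 ^ 81 by positivity])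
      (by positivity)
  · refine (OFA.relaxationTime_le (by positivity) (OFA.exists_poincare hk hε0 hε1 hpk)).trans
      (ENNReal.ofReal_le_ofReal ?_)
    have h1 : δ ^ 162 ≤ (k * δ) ^ 162 :=
      pow_le_pow_left₀ hδ0.le (by nlinarith) 162
    have e3 : 90 * (9 / (k * δ) ^ 2) ^ 81 = 90 * 9 ^ 81 * ((k * δ) ^ 162)⁻¹ := by
      rw [div_pow, ← pow_mul, div_eq_mul_inv, mul_assoc]
    rw [e3]
    refine mul_le_mul ?_ (inv_anti₀ (by positivity) h1) (by positivity) (by positivity)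
    exact le_add_of_nonneg_left (by positivity)
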